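/- Let $0<\alpha<1$ and $\beta,c,\sigma,b>0$. Let $L$ be the classical tempered stable subordinator, i.e. the driftless pure-jump subordinator with Lévy density $c\,e^{-\beta x}x^{-1-\alpha}$, $x>0$; let $W$ be a standard Brownian motion independent of $L$; and let $Y(t)=\sigma W(L(t))$ be the corresponding symmetric normal tempered stable process. For $t\ge 0$ let $$Z_Y(t)=\int_0^t e^{-b(t-s)}\,dY(s)$$ (the limit in probability of the Riemann–Stieltjes sums along partitions of $[0,t]$ whose mesh tends to $0$, which exists), and let $\psi_{Z_Y}(u,t)$, $u\in\mathbb R$, be its logarithmic characteristic, i.e. the continuous function of $u$ with $\psi_{Z_Y}(0,t)=0$ and $\mathbb E\,e^{iuZ_Y(t)}=e^{\psi_{Z_Y}(u,t)}$. Put $\omega=e^{-2bt}$. (i) For all $t\ge 0$ and $u\in\mathbb R$, $$\psi_{Z_Y}(u,t)=-\frac{c\,\beta^{\alpha}\,\Gamma(1-\alpha)}{2\alpha b}\Big[J\big(u,\sigma,\alpha,\beta,\tfrac{\beta}{\omega}\big)+\log\omega\Big],\qquad J(u,\sigma,\alpha,\beta_1,\beta_2)=\int_{\beta_1}^{\beta_2}z^{-1-\alpha}\Big(z+\frac{\sigma^2u^2}{2}\Big)^{\alpha}dz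 .$$ (ii) For all $u\neq 0$ and $0<\beta_1<\beta_2$, $$J(u,\sigma,\alpha,\beta_1,\beta_2)=-\frac1\alpha\Big[\Big(\frac{\sigma^2u^2}{2\beta_2}\Big)^{\alpha}{}_2F_1\Big(-\alpha,-\alpha;1-\alpha;-\frac{2\beta_2}{\sigma^2u^2}\Big)-\Big(\frac{\sigma^2u^2}{2\beta_1}\Big)^{\alpha}{}_2F_1\Big(-\alpha,-\alpha;1-\alpha;-\frac{2\beta_1}{\sigma^2u^2}\Big)\Big],$$ where ${}_2F_1(a,b;c;\cdot)$ is the Gauss hypergeometric function, i.e. the analytic continuation of the hypergeometric series to $\mathbb C\setminus[1,\infty)$. (iii) For $\alpha=1/2$ the hypergeometric function in (ii) is elementary: for all $x\ge 0$, $${}_2F_1\big(-\tfrac12,-\tfrac12;\tfrac12;-x\big)=\sqrt{x+1}-\sqrt{x}\,\sinh^{-1}(\sqrt{x}),\qquad \sinh^{-1}x=\log\big(\sqrt{x^2+1}+x\big).$$ -/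

import Mathlib

open MeasureTheory ProbabilityTheory Filter Topology Set
open scoped NNReal ENNReal

/-! ### The Gauss hypergeometric function on the cut plane -/

/-- The cut plane `ℂ ∖ [1, ∞)`. -/
def cutPlane : Set ℂ := {z | 1 - z ∈ Complex.slitPlane}

/-- `F` is a holomorphic function on `ℂ ∖ [1, ∞)` which is given on the open unit disc by the
Gauss hypergeometric series with parameters `a, b, c`. -/
structure IsGaussContinuation (a b c : ℂ) (F : ℂ → ℂ) : Prop where
  differentiableOn : DifferentiableOn ℂ F cutPlane
  eq_series : ∀ z : ℂ, ‖z‖ < 1 → F z = ordinaryHypergeometric a b c z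

/-- The continuation is unique, so that the choice made in `gaussHypergeometric` is immaterial. -/
theorem IsGaussContinuation.eqOn {a b c : ℂ} {F G : ℂ → ℂ} (hF : IsGaussContinuation a b c F)
    (hG : IsGaussContinuation a b c G) : EqOn F G cutPlane := by
  have hopen : IsOpen cutPlane :=
    Complex.isOpen_slitPlane.preimage (continuous_const.sub continuous_id)
  have hstar : StarConvex ℝ (0 : ℂ) cutPlane := by
    intro z hz s t hs ht hst
    have h := Complex.starConvex_one_slitPlane hz hs ht hst
    have e : (1 : ℂ) - (s • (0 : ℂ) + t • z) = s • (1 : ℂ) + t • (1 - z) := by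
      have : (s : ℂ) + t = 1 := by exact_mod_cast hst
      simp only [Complex.real_smul]
      linear_combination -this
    change 1 - (s • (0 : ℂ) + t • z) ∈ Complex.slitPlane
    rw [e]; exact h
  have h0 : (0 : ℂ) ∈ cutPlane := by simp [cutPlane]
  have hpre : IsPreconnected cutPlane := (hstar.isPathConnected h0).isConnected.isPreconnected
  refine (hF.differentiableOn.analyticOnNhd hopen).eqOn_of_preconnected_of_eventuallyEq
    (hG.differentiableOn.analyticOnNhd hopen) hpre h0 ?_
  filter_upwards [Metric.ball_mem_nhds (0 : ℂ) one_pos] with z hz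
  have hz' : ‖z‖ < 1 := by simpa using hz
  rw [hF.eq_series z hz', hG.eq_series z hz']

open Classical in
/-- The Gauss hypergeometric function `₂F₁(a, b; c; z)`: the analytic continuation of the
hypergeometric series to `ℂ ∖ [1, ∞)`. -/
noncomputable def gaussHypergeometric (a b c z : ℂ) : ℂ :=
  if h : ∃ F : ℂ → ℂ, IsGaussContinuation a b c F then h.choose z else 0

/-! ### Tempered stable subordinators -/

/-- The Lévy measure of the classical tempered stable subordinator: density
`c e^{-β x} / x^{1+α}` on the positive half line. -/
noncomputable def temperedStableMeasure (α β c : ℝ) : Measure ℝ :=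
  (volume.restrict (Ioi 0)).withDensity
    (fun x => ENNReal.ofReal (c * Real.exp (-β * x) / x ^ (1 + α)))

/-- `L` is a pure jump (driftless) subordinator with Lévy measure `ν`: a Lévy process with
nondecreasing right-continuous paths, whose Laplace exponent is given by `ν`. -/
structure IsPureJumpSubordinator {Ω : Type*} [MeasurableSpace Ω] (ν : Measure ℝ)
    (L : ℝ≥0 → Ω → ℝ≥0) (P : Measure Ω) : Prop where
  measure_Iic : ν (Iic 0) = 0
  lintegral_min : ∫⁻ x, ENNReal.ofReal (min x 1) ∂ν < ∞
  aemeasurable : ∀ t, AEMeasurable (L t) P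
  start : ∀ᵐ ω ∂P, L 0 ω = 0
  mono : ∀ᵐ ω ∂P, Monotone (fun t => L t ω)
  right_cont : ∀ᵐ ω ∂P, ∀ t, ContinuousWithinAt (fun s => L s ω) (Ioi t) t
  indep : HasIndepIncrements (fun t ω => (L t ω : ℝ)) P
  stationary : ∀ s h : ℝ≥0,
    IdentDistrib (fun ω => (L (s + h) ω : ℝ) - (L s ω : ℝ)) (fun ω => (L h ω : ℝ)) P P
  laplace : ∀ (t : ℝ≥0) (r : ℝ), 0 ≤ r →
    ∫ ω, Real.exp (-r * (L t ω : ℝ)) ∂P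
      = Real.exp (-(t : ℝ) * ∫ x, (1 - Real.exp (-r * x)) ∂ν)

/-- The subordinated Brownian motion `Y(t) = σ W(L(t))`. -/
def subordinated {Ω : Type*} (σ : ℝ) (W : ℝ≥0 → Ω → ℝ) (L : ℝ≥0 → Ω → ℝ≥0) :
    ℝ≥0 → Ω → ℝ := fun t ω => σ * W (L t ω) ω

/-! ### The Ornstein–Uhlenbeck integral -/

/-- `Z` is the stochastic integral `∫₀ᵗ f(s) dY(s)` of the deterministic function `f`: the limit
in probability of the Riemann–Stieltjes sums along every sequence of partitions
`0 = τ k 0 ≤ τ k 1 ≤ ⋯ ≤ τ k (n k) = t` whose mesh tends to zero. -/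
def IsStochIntegral {Ω : Type*} [MeasurableSpace Ω] (P : Measure Ω) (f : ℝ → ℝ)
    (Y : ℝ≥0 → Ω → ℝ) (t : ℝ≥0) (Z : Ω → ℝ) : Prop :=
  ∀ (n : ℕ → ℕ) (τ : ℕ → ℕ → ℝ≥0),
    (∀ k, Monotone (τ k) ∧ τ k 0 = 0 ∧ τ k (n k) = t) →
    (∀ ε : ℝ, 0 < ε → ∀ᶠ k in atTop, ∀ i < n k, (τ k (i + 1) : ℝ) - τ k i < ε) →
    TendstoInMeasure P
      (fun k ω => ∑ i ∈ Finset.range (n k),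
        f (τ k i) * (Y (τ k (i + 1)) ω - Y (τ k i) ω)) atTop Z

/-- `Z` is the Ornstein–Uhlenbeck integral `Z_Y(t) = ∫₀ᵗ e^{-b (t - s)} dY(s)`. -/
def IsOUIntegral {Ω : Type*} [MeasurableSpace Ω] (P : Measure Ω) (b : ℝ)
    (Y : ℝ≥0 → Ω → ℝ) (t : ℝ≥0) (Z : Ω → ℝ) : Prop :=
  IsStochIntegral P (fun s => Real.exp (-b * ((t : ℝ) - s))) Y t Z

/-- `ψ` is the logarithmic characteristic of `μ`: the continuous logarithm, vanishing at `0`, of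
the characteristic function of `μ`. -/
structure IsLogCharFun (ψ : ℝ → ℂ) (μ : Measure ℝ) : Prop where
  continuous : Continuous ψ
  map_zero : ψ 0 = 0
  charFun_eq : ∀ u, charFun μ u = Complex.exp (ψ u)

/-- `J(u, σ, α, β₁, β₂) = ∫_{β₁}^{β₂} z^{-1-α} (z + σ² u² / 2)^α dz`. -/
noncomputable def integralJ (u σ α β₁ β₂ : ℝ) : ℝ :=
  ∫ z in β₁..β₂, z ^ (-1 - α) * (z + σ ^ 2 * u ^ 2 / 2) ^ α

/-!
The logarithmic characteristic of the Ornstein–Uhlenbeck integral of a normal tempered stable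
process, and its expression through Gauss hypergeometric functions.

*The stochastic integral.* Summation by parts turns a Riemann–Stieltjes sum of `f` against a path
of `Y = σ W(L)` into boundary terms minus a Riemann sum of that path against `f'`. The path is
bounded on `[0, t]` and continuous off the countable set of jumps of the monotone path of `L`, so
the sums converge path by path by dominated convergence
(`exists_isStochIntegral_subordinated`), and a fortiori in probability; no moments are needed.

*Its characteristic function.* Given `L`, the increments of `W(L)` along a partition are
independent centred Gaussians with variances the increments of `L`
(`integral_cexp_sum_subordinated`). Since `(w, l) ↦ w(l)` is not jointly measurable on the space
of all functions `w`, the conditioning is carried out for `L` rounded to a grid, and the rounding is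
removed by path continuity. With the independent stationary increments of `L` and its Laplace exponent
`Φ(r) = ∫ (1 - exp (-r x)) ν(dx)`, the characteristic function of a Riemann–Stieltjes sum is the
exponential of a Riemann sum of `-Φ(σ² u² f² / 2)`, which yields
`exp (-∫₀ᵗ Φ(σ² u² f(s)² / 2) ds)` in the limit (`charFun_of_isStochIntegral`). For the tempered
stable Lévy measure `Φ(r) = c Γ(1 - α) / α * ((β + r) ^ α - β ^ α)`, by an integration by parts, and
the substitution `z = β exp (2 b (t - s))` produces the integral `J`.

*The hypergeometric function.* The classical Euler integral for `₂F₁(-α, -α; 1 - α; z)` diverges;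
its regularisation `1 - α ∫₀¹ t ^ (-1 - α) * ((1 - z t) ^ α - 1) dt` converges, is holomorphic on
the cut plane, and is the hypergeometric series on the unit disc by termwise integration of the
binomial series (`gaussHypergeometric_eq_eulerIntegral`). At `z = -x` the substitution `s = x t`
makes `x ^ (-α) ₂F₁(-α, -α; 1 - α; -x)` a primitive of `-α x ^ (-1 - α) (1 + x) ^ α`, which is
`-α` times the integrand of `J` after rescaling. For `α = 1 / 2` the integral has an explicit primitive.
-/

/-! ### The regularised Euler integral -/

/-- The binomial series, with coefficients written as in the hypergeometric series. -/
theorem hasSum_one_sub_cpow {α : ℝ} (hα0 : 0 < α) (hα1 : α < 1) {w : ℂ} (hw : ‖w‖ < 1) :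
    HasSum (fun n : ℕ => ((n.factorial : ℂ)⁻¹ * (ascPochhammer ℂ n).eval (-(α : ℂ))) * w ^ n)
      ((1 - w) ^ (α : ℂ)) := by
  have hne : ∀ k : ℕ, (k : ℂ) ≠ -(-(α : ℂ)) := by
    intro k hk
    rw [neg_neg] at hk
    have hk' : (k : ℝ) = α := by exact_mod_cast hk
    rcases Nat.eq_zero_or_pos k with rfl | h
    · simp at hk'; linarith
    · have : (1 : ℝ) ≤ k := by exact_mod_cast h
      linarith
  have h := (Complex.one_add_cpow_hasFPowerSeriesOnBall_zero (a := (α : ℂ))).hasSum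
    (y := -w) (by
      rw [mem_eball_zero_iff, enorm_neg]
      exact enorm_lt_coe.2 hw)
  rw [binomialSeries_eq_ordinaryHypergeometricSeries (b := -(α : ℂ)) hne] at h
  rw [zero_add, ← sub_eq_add_neg] at h
  convert! h using 2 with n
  have hpoch : (ascPochhammer ℂ n).eval (-(α : ℂ)) ≠ 0 := by
    rw [Ne, ascPochhammer_eval_eq_zero_iff]
    rintro ⟨k, -, hk⟩
    exact hne k hk
  rw [FormalMultilinearSeries.compContinuousLinearMap_apply]
  have : (⇑(-ContinuousLinearMap.id ℂ ℂ) ∘ fun _ : Fin n => -w) = fun _ => w := by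
    ext; simp
  rw [this, ordinaryHypergeometricSeries_apply_eq, smul_eq_mul]
  field_simp

/-- Since `(a)ₙ / (a + 1)ₙ = a / (a + n)`, the hypergeometric coefficients with `c = b + 1` are
those of the binomial series multiplied by `a / (a + n)`. -/
theorem ascPochhammer_eval_mul_add (a : ℂ) (n : ℕ) :
    (ascPochhammer ℂ n).eval a * (a + n) = a * (ascPochhammer ℂ n).eval (a + 1) := by
  rw [← ascPochhammer_succ_eval, ascPochhammer_succ_left]
  simp

theorem isOpen_cutPlane : IsOpen cutPlane :=
  Complex.isOpen_slitPlane.preimage (continuous_const.sub continuous_id)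

/-- The cut plane is star-shaped about `0`. -/
theorem mul_mem_cutPlane {z : ℂ} (hz : z ∈ cutPlane) {t : ℝ} (ht : t ∈ Icc (0 : ℝ) 1) :
    z * t ∈ cutPlane := by
  have h := Complex.starConvex_one_slitPlane hz (sub_nonneg.2 ht.2) ht.1 (by ring)
  have e : (1 : ℂ) - z * t = (1 - t : ℝ) • (1 : ℂ) + t • (1 - z) := by
    simp only [Complex.real_smul]; push_cast; ring
  change 1 - z * t ∈ Complex.slitPlane
  rw [e]; exact h

/-- The integrand `t ^ (-1 - α) * ((1 - z t) ^ α - 1)` whose integral over `[0, 1]` continues the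
hypergeometric series. Subtracting `1` makes it integrable at `0`, where the exponent `-1 - α` of
the classical Euler integral is too small. -/
noncomputable def eulerIntegrand (α : ℝ) (z : ℂ) (t : ℝ) : ℂ :=
  ((t ^ (-1 - α) : ℝ) : ℂ) * ((1 - z * t) ^ (α : ℂ) - 1)

theorem measurable_eulerIntegrand (α : ℝ) (z : ℂ) : Measurable (eulerIntegrand α z) := by
  unfold eulerIntegrand
  fun_prop

theorem hasDerivAt_one_sub_mul_cpow (α : ℝ) {z : ℂ} {t : ℝ} (h : z * t ∈ cutPlane) :
    HasDerivAt (fun z : ℂ => (1 - z * t) ^ (α : ℂ))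
      (-(α * t) * (1 - z * t) ^ ((α : ℂ) - 1)) z := by
  have h1 : HasDerivAt (fun z : ℂ => 1 - z * t) (-(1 * (t : ℂ))) z :=
    ((hasDerivAt_id z).mul_const (t : ℂ)).const_sub 1
  convert h1.cpow_const (c := (α : ℂ)) h using 1
  ring

/-- The derivative factor `(1 - z t) ^ (α - 1)` is bounded for `z` in a compact subset of the cut
plane, uniformly in `t ∈ [0, 1]`. -/
theorem exists_bound_cpow_sub_one (α : ℝ) {K : Set ℂ} (hK : IsCompact K) (hKc : K ⊆ cutPlane) :
    ∃ M : ℝ, 0 ≤ M ∧ ∀ z ∈ K, ∀ t ∈ Icc (0 : ℝ) 1, ‖(1 - z * t) ^ ((α : ℂ) - 1)‖ ≤ M := by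
  have hc : ContinuousOn (fun p : ℂ × ℝ => (1 - p.1 * p.2) ^ ((α : ℂ) - 1))
      (K ×ˢ Icc (0 : ℝ) 1) := by
    refine ContinuousOn.cpow_const (by fun_prop) ?_
    rintro ⟨z, t⟩ ⟨hz, ht⟩
    exact mul_mem_cutPlane (hKc hz) ht
  obtain ⟨M, hM⟩ := (hK.prod isCompact_Icc).exists_bound_of_continuousOn hc
  exact ⟨max M 0, le_max_right _ _, fun z hz t ht => (hM (z, t) ⟨hz, ht⟩).trans (le_max_left _ _)⟩

theorem intervalIntegrable_eulerIntegrand {α : ℝ} (hα0 : 0 < α) (hα1 : α < 1) {z : ℂ}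
    (hz : z ∈ cutPlane) : IntervalIntegrable (eulerIntegrand α z) volume 0 1 := by
  obtain ⟨M, hM0, hM⟩ := exists_bound_cpow_sub_one α isCompact_singleton (singleton_subset_iff.2 hz)
  have hbound : ∀ t ∈ Icc (0 : ℝ) 1, ‖(1 - z * t) ^ (α : ℂ) - 1‖ ≤ (α * ‖z‖ * M) * t := by
    intro t ht
    -- mean value inequality along the segment from `0` to `z`
    have hd : ∀ s ∈ Icc (0 : ℝ) 1, HasDerivWithinAt (fun s : ℝ => (1 - z * s) ^ (α : ℂ))
        (-(α * z) * (1 - z * s) ^ ((α : ℂ) - 1)) (Icc 0 1) s := by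
      intro s hs
      have h1 : HasDerivAt (fun s : ℂ => 1 - z * s) (-(z * 1)) (s : ℂ) :=
        ((hasDerivAt_id (s : ℂ)).const_mul z).const_sub 1
      convert! (h1.cpow_const (c := (α : ℂ))
        (mul_mem_cutPlane hz hs)).comp_ofReal.hasDerivWithinAt using 1
      ring
    have := Convex.norm_image_sub_le_of_norm_hasDerivWithin_le (C := α * ‖z‖ * M) hd ?_
      (convex_Icc 0 1) (left_mem_Icc.2 zero_le_one) ht
    · simpa [abs_of_nonneg ht.1] using this
    · intro s hs
      rw [norm_mul, norm_neg, norm_mul, Complex.norm_real, Real.norm_of_nonneg hα0.le]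
      exact mul_le_mul_of_nonneg_left (hM z rfl s hs) (by positivity)
  refine ((intervalIntegral.intervalIntegrable_rpow' (r := -α) (by linarith)).const_mul
    (α * ‖z‖ * M)).mono_fun (measurable_eulerIntegrand α z).aestronglyMeasurable ?_
  refine (ae_restrict_iff' measurableSet_uIoc).2 (.of_forall fun t ht => ?_)
  rw [uIoc_of_le zero_le_one] at ht
  have hb := hbound t ⟨ht.1.le, ht.2⟩
  simp only [eulerIntegrand]
  rw [norm_mul, Complex.norm_real, Real.norm_of_nonneg (Real.rpow_nonneg ht.1.le _),
    Real.norm_of_nonneg (mul_nonneg (by positivity) (Real.rpow_nonneg ht.1.le _))]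
  refine (mul_le_mul_of_nonneg_left hb (Real.rpow_nonneg ht.1.le _)).trans_eq ?_
  have : t ^ (-α) = t ^ (-1 - α) * t := by
    rw [← Real.rpow_add_one ht.1.ne']; ring_nf
  rw [this]; ring

/-- The regularised Euler integral `1 - α ∫₀¹ t ^ (-1 - α) * ((1 - z t) ^ α - 1) dt`, which
continues `₂F₁(-α, -α; 1 - α; z)` to the cut plane. -/
noncomputable def eulerIntegral (α : ℝ) (z : ℂ) : ℂ :=
  1 - α * ∫ t in (0 : ℝ)..1, eulerIntegrand α z t

theorem differentiableOn_eulerIntegral {α : ℝ} (hα0 : 0 < α) (hα1 : α < 1) :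
    DifferentiableOn ℂ (eulerIntegral α) cutPlane := by
  intro z₀ hz₀
  obtain ⟨ε, hε, hball⟩ := Metric.nhds_basis_closedBall.mem_iff.1 (isOpen_cutPlane.mem_nhds hz₀)
  obtain ⟨M, hM0, hM⟩ := exists_bound_cpow_sub_one α (isCompact_closedBall z₀ ε) hball
  have h := intervalIntegral.hasDerivAt_integral_of_dominated_loc_of_deriv_le
    (μ := volume) (a := 0) (b := 1) (F := eulerIntegrand α)
    (F' := fun z t => ((t ^ (-1 - α) : ℝ) : ℂ) * (-(α * t) * (1 - z * t) ^ ((α : ℂ) - 1)))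
    (bound := fun t => (α * M) * t ^ (-α)) (Metric.closedBall_mem_nhds z₀ hε)
    (.of_forall fun z => (measurable_eulerIntegrand α z).aestronglyMeasurable)
    (intervalIntegrable_eulerIntegrand hα0 hα1 hz₀)
    (Measurable.aestronglyMeasurable (by fun_prop)) ?_
    ((intervalIntegral.intervalIntegrable_rpow' (by linarith)).const_mul _) ?_
  · exact ((h.2.const_mul (α : ℂ)).const_sub 1).differentiableAt.differentiableWithinAt
  · refine .of_forall fun t ht z hz => ?_
    rw [uIoc_of_le zero_le_one] at ht
    have hb := hM z hz t ⟨ht.1.le, ht.2⟩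
    have : t ^ (-α) = t ^ (-1 - α) * t := by
      rw [← Real.rpow_add_one ht.1.ne']; ring_nf
    rw [norm_mul, norm_mul, norm_neg, norm_mul, Complex.norm_real, Complex.norm_real,
      Complex.norm_real, Real.norm_of_nonneg hα0.le, Real.norm_of_nonneg ht.1.le,
      Real.norm_of_nonneg (Real.rpow_nonneg ht.1.le _), this]
    have h0 : 0 ≤ t ^ (-1 - α) * (α * t) :=
      mul_nonneg (Real.rpow_nonneg ht.1.le _) (mul_nonneg hα0.le ht.1.le)
    nlinarith [mul_le_mul_of_nonneg_left hb h0]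
  · refine .of_forall fun t ht z hz => ?_
    rw [uIoc_of_le zero_le_one] at ht
    exact ((hasDerivAt_one_sub_mul_cpow α
      (mul_mem_cutPlane (hball hz) ⟨ht.1.le, ht.2⟩)).sub_const 1).const_mul _

/-- On the unit disc, expand `(1 - z t) ^ α - 1` in its binomial series and integrate termwise
against `t ^ (-1 - α)`: the `n`-th term acquires the factor `-α / (n - α) = (-α)ₙ / (1 - α)ₙ`. -/
theorem eulerIntegral_eq_ordinaryHypergeometric {α : ℝ} (hα0 : 0 < α) (hα1 : α < 1) {z : ℂ}
    (hz : ‖z‖ < 1) :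
    eulerIntegral α z = ordinaryHypergeometric (-(α : ℂ)) (-(α : ℂ)) (1 - (α : ℂ)) z := by
  set A : ℕ → ℂ := fun n => (n.factorial : ℂ)⁻¹ * (ascPochhammer ℂ n).eval (-(α : ℂ)) with hA
  have hA0 : A 0 = 1 := by simp [hA]
  have hn : ∀ n : ℕ, (0 : ℝ) < (n + 1 : ℕ) - α := by
    intro n; push_cast; linarith [n.cast_nonneg (α := ℝ)]
  set f : ℕ → ℝ → ℂ := fun n t => (A (n + 1) * z ^ (n + 1)) * ((t ^ ((n : ℝ) - α) : ℝ) : ℂ) with hf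
  have hexp : ∀ n : ℕ, (-1 : ℝ) < (n : ℝ) - α := fun n => by linarith [n.cast_nonneg (α := ℝ)]
  have hrp : ∀ n : ℕ, ∫ t in (0 : ℝ)..1, t ^ ((n : ℝ) - α) = 1 / ((n + 1 : ℕ) - α) := by
    intro n
    rw [integral_rpow (Or.inl (hexp n)), Real.one_rpow, Real.zero_rpow (by linarith [hexp n])]
    push_cast; ring_nf
  have hint : ∀ n, Integrable (f n) (volume.restrict (Ioc 0 1)) := fun n =>
    (((intervalIntegral.intervalIntegrable_rpow' (hexp n)).1).ofReal).const_mul _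
  have hnorm : ∀ n, ∫ t in Ioc (0 : ℝ) 1, ‖f n t‖ =
      ‖A (n + 1) * z ^ (n + 1)‖ / ((n + 1 : ℕ) - α) := by
    intro n
    rw [setIntegral_congr_fun (g := fun t => ‖A (n + 1) * z ^ (n + 1)‖ * t ^ ((n : ℝ) - α))
      measurableSet_Ioc, integral_const_mul, ← intervalIntegral.integral_of_le zero_le_one, hrp,
      mul_one_div]
    intro t ht
    simp only [hf, norm_mul, Complex.norm_real, Real.norm_of_nonneg (Real.rpow_nonneg ht.1.le _)]
  have hsumA : Summable fun n => ‖A (n + 1) * z ^ (n + 1)‖ :=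
    (summable_nat_add_iff 1 (f := fun n => ‖A n * z ^ n‖)).2
      (hasSum_one_sub_cpow hα0 hα1 hz).summable.norm
  have hsum : Summable fun n => ∫ t in Ioc (0 : ℝ) 1, ‖f n t‖ := by
    simp only [hnorm]
    refine .of_nonneg_of_le (fun n => div_nonneg (norm_nonneg _) (hn n).le) (fun n => ?_)
      (hsumA.mul_right (1 - α)⁻¹)
    rw [div_eq_mul_inv]
    refine mul_le_mul_of_nonneg_left (inv_anti₀ (by linarith) ?_) (norm_nonneg _)
    push_cast; linarith [n.cast_nonneg (α := ℝ)]
  have key := hasSum_integral_of_summable_integral_norm hint hsum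
  have hval : ∫ t in Ioc (0 : ℝ) 1, ∑' n, f n t = ∫ t in (0 : ℝ)..1, eulerIntegrand α z t := by
    rw [intervalIntegral.integral_of_le zero_le_one]
    refine setIntegral_congr_fun measurableSet_Ioc fun t ht => ?_
    have hzt : ‖z * t‖ < 1 := by
      rw [norm_mul, Complex.norm_real, Real.norm_of_nonneg ht.1.le]
      nlinarith [norm_nonneg z, ht.1, ht.2]
    have h1 := (hasSum_nat_add_iff' (f := fun n => A n * (z * t) ^ n) 1).2
      (hasSum_one_sub_cpow hα0 hα1 hzt)
    simp only [Finset.sum_range_one, hA0, pow_zero, mul_one] at h1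
    rw [eulerIntegrand, ← (h1.mul_left (((t ^ (-1 - α) : ℝ) : ℂ))).tsum_eq]
    refine tsum_congr fun n => ?_
    have : t ^ ((n : ℝ) - α) = t ^ (-1 - α) * t ^ (n + 1) := by
      rw [← Real.rpow_natCast, ← Real.rpow_add ht.1]; push_cast; ring_nf
    simp only [hf, this, mul_pow]; push_cast; ring
  have hterm : ∀ n, ∫ t in Ioc (0 : ℝ) 1, f n t =
      (A (n + 1) * z ^ (n + 1)) * (1 / ((n + 1 : ℕ) - (α : ℂ))) := by
    intro n
    simp only [hf]
    rw [integral_const_mul, ← intervalIntegral.integral_of_le zero_le_one,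
      intervalIntegral.integral_ofReal, hrp]
    push_cast; rfl
  rw [hval] at key
  simp only [hterm] at key
  have hfin : HasSum (fun n : ℕ => ((n.factorial : ℂ)⁻¹ * (ascPochhammer ℂ n).eval (-(α : ℂ)) *
      (ascPochhammer ℂ n).eval (-(α : ℂ)) * ((ascPochhammer ℂ n).eval (1 - (α : ℂ)))⁻¹) * z ^ n)
      (eulerIntegral α z) := by
    rw [← hasSum_nat_add_iff' 1]
    simp only [Finset.sum_range_one]
    have e : eulerIntegral α z - ((Nat.factorial 0 : ℂ)⁻¹ * (ascPochhammer ℂ 0).eval (-(α : ℂ)) *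
      (ascPochhammer ℂ 0).eval (-(α : ℂ)) * ((ascPochhammer ℂ 0).eval (1 - (α : ℂ)))⁻¹ * z ^ 0)
      = -(α : ℂ) * ∫ t in (0 : ℝ)..1, eulerIntegrand α z t := by
      simp [eulerIntegral]
    rw [e]
    convert! key.mul_left (-(α : ℂ)) using 2 with n
    have hP := ascPochhammer_eval_mul_add (-(α : ℂ)) (n + 1)
    have h1 : (ascPochhammer ℂ (n + 1)).eval (1 - (α : ℂ)) ≠ 0 := by
      rw [Ne, ascPochhammer_eval_eq_zero_iff]
      rintro ⟨k, -, hk⟩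
      have hk' : (k : ℝ) = -(1 - α) := by exact_mod_cast hk
      linarith [k.cast_nonneg (α := ℝ)]
    have h2 : ((n + 1 : ℕ) : ℂ) - α ≠ 0 := by exact_mod_cast (hn n).ne'
    have e1 : -(α : ℂ) + 1 = 1 - α := by ring
    have e2 : -(α : ℂ) + (n + 1 : ℕ) = (n + 1 : ℕ) - α := by ring
    rw [e1, e2] at hP
    simp only [hA]
    field_simp
    linear_combination
      ((ascPochhammer ℂ (n + 1)).eval (-(α : ℂ)) * z ^ (n + 1) * ((n + 1).factorial : ℂ)⁻¹) * hP
  rw [ordinaryHypergeometric_eq_tsum]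
  simp only [smul_eq_mul]
  exact hfin.tsum_eq.symm

/-- The regularised Euler integral is the value chosen in `gaussHypergeometric`. -/
theorem gaussHypergeometric_eq_eulerIntegral {α : ℝ} (hα0 : 0 < α) (hα1 : α < 1) {z : ℂ}
    (hz : z ∈ cutPlane) :
    gaussHypergeometric (-(α : ℂ)) (-(α : ℂ)) (1 - (α : ℂ)) z = eulerIntegral α z := by
  have hE : IsGaussContinuation (-(α : ℂ)) (-(α : ℂ)) (1 - (α : ℂ)) (eulerIntegral α) :=
    ⟨differentiableOn_eulerIntegral hα0 hα1,
      fun z hz => eulerIntegral_eq_ordinaryHypergeometric hα0 hα1 hz⟩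
  have hex : ∃ F : ℂ → ℂ, IsGaussContinuation (-(α : ℂ)) (-(α : ℂ)) (1 - (α : ℂ)) F := ⟨_, hE⟩
  rw [gaussHypergeometric, dif_pos hex]
  exact hex.choose_spec.eqOn hE hz

/-! ### The integral `J` in terms of the hypergeometric function -/

theorem intervalIntegrable_rpow_mul_one_add_rpow_sub_one {α x : ℝ} (hα0 : 0 < α) (hα1 : α < 1)
    (hx : 0 ≤ x) :
    IntervalIntegrable (fun s : ℝ => s ^ (-1 - α) * ((1 + s) ^ α - 1)) volume 0 x := by
  refine ((intervalIntegral.intervalIntegrable_rpow' (r := -α) (by linarith)).const_mul α).mono_fun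
    (Measurable.aestronglyMeasurable (by fun_prop)) ?_
  refine (ae_restrict_iff' measurableSet_uIoc).2 (.of_forall fun t ht => ?_)
  rw [uIoc_of_le hx] at ht
  have h1 : (1 + t) ^ α ≤ 1 + α * t :=
    rpow_one_add_le_one_add_mul_self (by linarith [ht.1]) hα0.le hα1.le
  have h2 : 1 ≤ (1 + t) ^ α := Real.one_le_rpow (by linarith [ht.1]) hα0.le
  have h3 : t ^ (-α) = t ^ (-1 - α) * t := by
    rw [← Real.rpow_add_one ht.1.ne']; ring_nf
  have h4 := Real.rpow_nonneg ht.1.le (-1 - α)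
  simp only
  rw [Real.norm_of_nonneg (mul_nonneg h4 (by linarith)),
    Real.norm_of_nonneg (mul_nonneg hα0.le (Real.rpow_nonneg ht.1.le _)), h3]
  nlinarith [mul_le_mul_of_nonneg_left (show (1 + t) ^ α - 1 ≤ α * t by linarith) h4]

theorem neg_mem_cutPlane {x : ℝ} (hx : 0 ≤ x) : ((-x : ℝ) : ℂ) ∈ cutPlane := by
  left
  simp; linarith

/-- On the negative half line the substitution `s = x t` moves the argument of the Euler integral to
its upper limit. -/
theorem eulerIntegral_neg {α x : ℝ} (hx : 0 < x) :
    eulerIntegral α ((-x : ℝ) : ℂ) =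
      ((1 - α * x ^ α * ∫ s in (0 : ℝ)..x, s ^ (-1 - α) * ((1 + s) ^ α - 1) : ℝ) : ℂ) := by
  have h1 : ∀ t ∈ uIcc (0 : ℝ) 1, eulerIntegrand α ((-x : ℝ) : ℂ) t =
      ((x ^ (1 + α) * ((x * t) ^ (-1 - α) * ((1 + x * t) ^ α - 1)) : ℝ) : ℂ) := by
    intro t ht
    rw [uIcc_of_le zero_le_one] at ht
    have e : (1 : ℂ) - ((-x : ℝ) : ℂ) * t = ((1 + x * t : ℝ) : ℂ) := by push_cast; ring
    have e2 : t ^ (-1 - α) = x ^ (1 + α) * (x * t) ^ (-1 - α) := by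
      rw [Real.mul_rpow hx.le ht.1, ← mul_assoc, ← Real.rpow_add hx]
      simp
    simp only [eulerIntegrand]
    rw [e, ← Complex.ofReal_cpow (by nlinarith [ht.1]), e2]
    push_cast; ring
  rw [eulerIntegral, intervalIntegral.integral_congr h1, intervalIntegral.integral_ofReal,
    intervalIntegral.integral_const_mul,
    intervalIntegral.integral_comp_mul_left (fun s => s ^ (-1 - α) * ((1 + s) ^ α - 1)) hx.ne',
    mul_zero, mul_one, smul_eq_mul, ← mul_assoc (x ^ (1 + α)),
    show x ^ (1 + α) * x⁻¹ = x ^ α by rw [add_comm, Real.rpow_add_one hx.ne']; field_simp]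
  push_cast; ring

theorem eulerIntegral_zero (α : ℝ) : eulerIntegral α 0 = 1 := by
  simp [eulerIntegral, eulerIntegrand]

/-- Differences of `x ^ (-α) ₂F₁(-α, -α; 1 - α; -x)` are elementary integrals: the subtracted `1`
in the regularised Euler integral cancels against the difference of the powers `x ^ (-α)`. -/
theorem integral_rpow_mul_one_add_rpow {α x₁ x₂ : ℝ} (hα0 : 0 < α) (hα1 : α < 1) (h1 : 0 < x₁)
    (h12 : x₁ < x₂) :
    ((∫ s in x₁..x₂, s ^ (-1 - α) * (1 + s) ^ α : ℝ) : ℂ) =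
      -(1 / (α : ℂ)) * (((x₂ ^ (-α) : ℝ) : ℂ) * eulerIntegral α ((-x₂ : ℝ) : ℂ)
        - ((x₁ ^ (-α) : ℝ) : ℂ) * eulerIntegral α ((-x₁ : ℝ) : ℂ)) := by
  have h2 : 0 < x₂ := h1.trans h12
  rw [eulerIntegral_neg h1, eulerIntegral_neg h2]
  have h0 : (0 : ℝ) ∉ uIcc x₁ x₂ := by
    rw [uIcc_of_le h12.le]; exact fun h => h1.not_ge h.1
  have hpow : IntervalIntegrable (fun s : ℝ => s ^ (-1 - α)) volume x₁ x₂ :=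
    intervalIntegral.intervalIntegrable_rpow (Or.inr h0)
  have hG1 := intervalIntegrable_rpow_mul_one_add_rpow_sub_one hα0 hα1 h1.le
  have hG2 := intervalIntegrable_rpow_mul_one_add_rpow_sub_one hα0 hα1 h2.le
  have e : ∫ s in x₁..x₂, s ^ (-1 - α) * (1 + s) ^ α =
      (∫ s in x₁..x₂, s ^ (-1 - α) * ((1 + s) ^ α - 1)) + ∫ s in x₁..x₂, s ^ (-1 - α) := by
    rw [← intervalIntegral.integral_add (hG1.symm.trans hG2) hpow]
    congr 1; ext s; ring
  rw [e, ← intervalIntegral.integral_interval_sub_left hG2 hG1,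
    integral_rpow (Or.inr ⟨by linarith, h0⟩), show -1 - α + 1 = -α by ring]
  have k1 : x₁ ^ (-α) * x₁ ^ α = 1 := by rw [← Real.rpow_add h1]; simp
  have k2 : x₂ ^ (-α) * x₂ ^ α = 1 := by rw [← Real.rpow_add h2]; simp
  set I1 := ∫ s in (0 : ℝ)..x₁, s ^ (-1 - α) * ((1 + s) ^ α - 1)
  set I2 := ∫ s in (0 : ℝ)..x₂, s ^ (-1 - α) * ((1 + s) ^ α - 1)
  suffices h : I2 - I1 + (x₂ ^ (-α) - x₁ ^ (-α)) / -α =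
      -(1 / α) * (x₂ ^ (-α) * (1 - α * x₂ ^ α * I2) - x₁ ^ (-α) * (1 - α * x₁ ^ α * I1)) by
    rw [h]; push_cast; rfl
  field_simp
  linear_combination α * I1 * k1 - α * I2 * k2

theorem integralJ_eq_integral_one_add {u σ α β₁ β₂ : ℝ} (hq : 0 < σ ^ 2 * u ^ 2 / 2)
    (h1 : 0 < β₁) (h12 : β₁ < β₂) :
    integralJ u σ α β₁ β₂ =
      ∫ s in (2 * β₁ / (σ ^ 2 * u ^ 2))..(2 * β₂ / (σ ^ 2 * u ^ 2)),
        s ^ (-1 - α) * (1 + s) ^ α := by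
  set q := σ ^ 2 * u ^ 2 / 2 with hqdef
  have e : ∀ x : ℝ, 2 * x / (σ ^ 2 * u ^ 2) = x / q := by
    intro x; rw [hqdef]; field_simp
  rw [e, e, integralJ, ← hqdef]
  have hc := intervalIntegral.integral_comp_mul_left (a := β₁ / q) (b := β₂ / q)
    (fun z => z ^ (-1 - α) * (z + q) ^ α) hq.ne'
  rw [mul_div_cancel₀ _ hq.ne', mul_div_cancel₀ _ hq.ne', smul_eq_mul] at hc
  rw [← mul_inv_cancel_left₀ hq.ne' (∫ z in β₁..β₂, z ^ (-1 - α) * (z + q) ^ α), ← hc,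
    ← intervalIntegral.integral_const_mul]
  refine intervalIntegral.integral_congr fun s hs => ?_
  rw [uIcc_of_le (div_le_div_of_nonneg_right h12.le hq.le)] at hs
  have hs0 : 0 < s := (div_pos h1 hq).trans_le hs.1
  have e1 : q * s + q = q * (1 + s) := by ring
  rw [e1, Real.mul_rpow hq.le hs0.le, Real.mul_rpow hq.le (by linarith)]
  have : q * (q ^ (-1 - α) * q ^ α) = 1 := by
    rw [← Real.rpow_add hq, show -1 - α + α = -1 by ring, Real.rpow_neg_one, mul_inv_cancel₀ hq.ne']
  linear_combination (s ^ (-1 - α) * (1 + s) ^ α) * this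

theorem integralJ_eq_gaussHypergeometric {u σ α β₁ β₂ : ℝ} (hα0 : 0 < α) (hα1 : α < 1)
    (hσ : 0 < σ) (hu : u ≠ 0) (h1 : 0 < β₁) (h12 : β₁ < β₂) :
    (integralJ u σ α β₁ β₂ : ℂ) =
        -(1 / (α : ℂ)) *
          ((((σ ^ 2 * u ^ 2 / (2 * β₂)) ^ α : ℝ) : ℂ) *
              gaussHypergeometric (-α) (-α) (1 - α)
                ((-(2 * β₂ / (σ ^ 2 * u ^ 2)) : ℝ) : ℂ)
            - (((σ ^ 2 * u ^ 2 / (2 * β₁)) ^ α : ℝ) : ℂ) *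
              gaussHypergeometric (-α) (-α) (1 - α)
                ((-(2 * β₁ / (σ ^ 2 * u ^ 2)) : ℝ) : ℂ)) := by
  have hq : 0 < σ ^ 2 * u ^ 2 := by positivity
  have h2 : 0 < β₂ := h1.trans h12
  have e : ∀ x : ℝ, 0 < x → (σ ^ 2 * u ^ 2 / (2 * x)) ^ α = (2 * x / (σ ^ 2 * u ^ 2)) ^ (-α) := by
    intro x hx
    rw [Real.rpow_neg (by positivity), ← Real.inv_rpow (by positivity), inv_div]
  rw [integralJ_eq_integral_one_add (by positivity) h1 h12, integral_rpow_mul_one_add_rpow hα0 hα1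
    (by positivity) (by gcongr), e _ h1, e _ h2,
    gaussHypergeometric_eq_eulerIntegral hα0 hα1 (neg_mem_cutPlane (by positivity)),
    gaussHypergeometric_eq_eulerIntegral hα0 hα1 (neg_mem_cutPlane (by positivity))]

/-! ### The elementary case `α = 1 / 2` -/

theorem integral_rpow_mul_sqrt_one_add_sub_one {x : ℝ} (hx : 0 < x) :
    ∫ s in (0 : ℝ)..x, s ^ (-1 - (1 / 2 : ℝ)) * ((1 + s) ^ (1 / 2 : ℝ) - 1) =
      2 * Real.arsinh √x - 2 * (√(1 + x) - 1) / √x := by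
  -- integrate `s ^ (-3 / 2)` by parts; the boundary term vanishes at `0`
  have hcont : ContinuousOn (fun s : ℝ => 2 * Real.arsinh √s - 2 * (√(1 + s) - 1) / √s)
      (Icc 0 x) := by
    have hc : Continuous fun s : ℝ => 2 * Real.arsinh √s - 2 * √s / (√(1 + s) + 1) := by
      have : ∀ s : ℝ, √(1 + s) + 1 ≠ 0 := fun s => by positivity
      refine ((Real.continuous_arsinh.comp Real.continuous_sqrt).const_mul 2).sub
        (Continuous.div (by fun_prop) (by fun_prop) this)
    -- rationalising `(√(1 + s) - 1) / √s` removes the singularity at `0`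
    refine hc.continuousOn.congr fun s hs => ?_
    rcases hs.1.eq_or_lt with rfl | h
    · simp
    · have h1 := Real.sq_sqrt h.le
      have h2 := Real.sq_sqrt (show 0 ≤ 1 + s by linarith)
      have h3 := Real.sqrt_pos.2 h
      have h4 := Real.sqrt_nonneg (1 + s)
      simp only
      congr 1
      rw [div_eq_div_iff h3.ne' (by positivity)]
      nlinarith
  have hderiv : ∀ s ∈ Ioo 0 x, HasDerivAt
      (fun s : ℝ => 2 * Real.arsinh √s - 2 * (√(1 + s) - 1) / √s)
      (s ^ (-1 - (1 / 2 : ℝ)) * ((1 + s) ^ (1 / 2 : ℝ) - 1)) s := by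
    intro s hs
    have h0 := hs.1
    have h3 := Real.sqrt_pos.2 h0
    have h4 : 0 < √(1 + s) := Real.sqrt_pos.2 (by linarith)
    have d1 := (Real.hasDerivAt_sqrt h0.ne').arsinh.const_mul 2
    have d2 := ((((hasDerivAt_id s).const_add 1).sqrt (by simp; linarith)).sub_const 1).const_mul 2
    convert! d1.sub (d2.div (Real.hasDerivAt_sqrt h0.ne') h3.ne') using 1
    have e1 : s ^ (-1 - (1 / 2 : ℝ)) = (s * √s)⁻¹ := by
      rw [show -1 - (1 / 2 : ℝ) = -(1 + 1 / 2) by ring, Real.rpow_neg h0.le, Real.rpow_add h0,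
        Real.rpow_one, ← Real.sqrt_eq_rpow]
    have q1 := Real.sq_sqrt h0.le
    rw [e1, ← Real.sqrt_eq_rpow]
    simp only [id_eq, smul_eq_mul]
    rw [q1]
    set a := √s
    set c := √(1 + s)
    rw [← q1]
    field_simp
    ring
  rw [intervalIntegral.integral_eq_sub_of_hasDerivAt_of_le hx.le hcont hderiv
    (intervalIntegrable_rpow_mul_one_add_rpow_sub_one (by norm_num) (by norm_num) hx.le)]
  simp

theorem gaussHypergeometric_neg_half {x : ℝ} (hx : 0 ≤ x) :
    gaussHypergeometric (-1 / 2) (-1 / 2) (1 / 2) ((-x : ℝ) : ℂ) =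
        ((√(x + 1) - √x * Real.arsinh (√x) : ℝ) : ℂ) := by
  have h := gaussHypergeometric_eq_eulerIntegral (α := 1 / 2) (by norm_num) (by norm_num)
    (neg_mem_cutPlane hx)
  have e1 : -(((1 / 2 : ℝ)) : ℂ) = -1 / 2 := by push_cast; ring
  have e2 : 1 - (((1 / 2 : ℝ)) : ℂ) = 1 / 2 := by push_cast; ring
  rw [e1, e2] at h
  rw [h]
  rcases hx.eq_or_lt with rfl | hx'
  · simp [eulerIntegral_zero]
  · rw [eulerIntegral_neg hx', integral_rpow_mul_sqrt_one_add_sub_one hx', ← Real.sqrt_eq_rpow]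
    congr 1
    have h3 := Real.sqrt_pos.2 hx'
    rw [add_comm x 1]
    field_simp
    ring

/-! ### The Laplace exponent of the tempered stable subordinator -/

theorem integrableOn_rpow_neg_mul_exp {α γ : ℝ} (hα1 : α < 1) (hγ : 0 < γ) :
    IntegrableOn (fun x : ℝ => x ^ (-α) * Real.exp (-γ * x)) (Ioi 0) := by
  simpa using integrableOn_rpow_mul_exp_neg_mul_rpow (p := 1) (s := -α) (b := γ) (by linarith)
    one_pos hγ

theorem exp_sub_exp_bounds {β r x : ℝ} (hr : 0 ≤ r) (hx : 0 ≤ x) :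
    0 ≤ Real.exp (-β * x) - Real.exp (-(β + r) * x) ∧
      Real.exp (-β * x) - Real.exp (-(β + r) * x) ≤ r * x * Real.exp (-β * x) := by
  have h : Real.exp (-(β + r) * x) = Real.exp (-β * x) * Real.exp (-(r * x)) := by
    rw [← Real.exp_add]; ring_nf
  have h1 := Real.add_one_le_exp (-(r * x))
  have h2 : Real.exp (-(r * x)) ≤ 1 := Real.exp_le_one_iff.2 (by nlinarith)
  have h3 := Real.exp_pos (-β * x)
  rw [h]
  constructor <;> nlinarith

/-- Integration by parts against the primitive `-x ^ (-α) / α` of `x ^ (-1 - α)` leaves two Gamma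
integrals; the difference of exponentials is `O(x)` at `0`, so the boundary terms vanish. -/
theorem integral_exp_sub_exp_mul_rpow {α β r : ℝ} (hα0 : 0 < α) (hα1 : α < 1) (hβ : 0 < β)
    (hr : 0 ≤ r) :
    ∫ x in Ioi (0 : ℝ), (Real.exp (-β * x) - Real.exp (-(β + r) * x)) * x ^ (-1 - α) =
      Real.Gamma (1 - α) / α * ((β + r) ^ α - β ^ α) := by
  have hβr : 0 < β + r := by linarith
  have hu : ∀ x ∈ Ioi (0 : ℝ), HasDerivAt (fun x => Real.exp (-β * x) - Real.exp (-(β + r) * x))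
      (Real.exp (-β * x) * (-β * 1) - Real.exp (-(β + r) * x) * (-(β + r) * 1)) x := fun x _ =>
    ((hasDerivAt_id x).const_mul (-β)).exp.sub ((hasDerivAt_id x).const_mul (-(β + r))).exp
  have hv : ∀ x ∈ Ioi (0 : ℝ), HasDerivAt (fun x : ℝ => -(1 / α) * x ^ (-α)) (x ^ (-1 - α)) x := by
    intro x hx
    convert! (Real.hasDerivAt_rpow_const (p := -α) (Or.inl (ne_of_gt hx))).const_mul (-(1 / α))
      using 1
    rw [show -α - 1 = -1 - α by ring]; field_simp
  have hΓ : ∀ γ : ℝ, 0 < γ →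
      γ * ∫ x in Ioi (0 : ℝ), x ^ (-α) * Real.exp (-γ * x) = γ ^ α * Real.Gamma (1 - α) := by
    intro γ hγ
    have h := Real.integral_rpow_mul_exp_neg_mul_Ioi (a := 1 - α) (by linarith) hγ
    rw [show 1 - α - 1 = -α by ring] at h
    simp only [neg_mul]
    rw [h, one_div, Real.inv_rpow hγ.le, ← Real.rpow_neg hγ.le, ← mul_assoc,
      ← Real.rpow_one_add' hγ.le (by linarith)]
    ring_nf
  have hint1 := (integrableOn_rpow_neg_mul_exp hα1 hβ)
  have hint2 := (integrableOn_rpow_neg_mul_exp hα1 hβr)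
  have huv' : IntegrableOn ((fun x => Real.exp (-β * x) - Real.exp (-(β + r) * x)) *
      fun x : ℝ => x ^ (-1 - α)) (Ioi 0) := by
    refine (hint1.const_mul r).mono' (Measurable.aestronglyMeasurable (by fun_prop)) ?_
    refine (ae_restrict_iff' measurableSet_Ioi).2 (.of_forall fun x hx => ?_)
    have hx : 0 < x := hx
    obtain ⟨h1, h2⟩ := exp_sub_exp_bounds (β := β) hr hx.le
    have h3 := Real.rpow_nonneg hx.le (-1 - α)
    have h4 : x ^ (-α) = x ^ (-1 - α) * x := by
      rw [← Real.rpow_add_one hx.ne']; ring_nf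
    simp only [Pi.mul_apply]
    rw [Real.norm_of_nonneg (mul_nonneg h1 h3), h4]
    nlinarith [mul_le_mul_of_nonneg_right h2 h3]
  have hu'v : IntegrableOn ((fun x => Real.exp (-β * x) * (-β * 1) -
      Real.exp (-(β + r) * x) * (-(β + r) * 1)) * fun x : ℝ => -(1 / α) * x ^ (-α)) (Ioi 0) := by
    refine Integrable.congr ((hint1.const_mul (β / α)).sub (hint2.const_mul ((β + r) / α)))
      (.of_forall fun x => ?_)
    simp only [Pi.mul_apply, Pi.sub_apply]
    ring
  have hzero : Tendsto ((fun x => Real.exp (-β * x) - Real.exp (-(β + r) * x)) *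
      fun x : ℝ => -(1 / α) * x ^ (-α)) (𝓝[>] 0) (𝓝 0) := by
    have hlim : Tendsto (fun x : ℝ => r / α * x ^ (1 - α)) (𝓝[>] 0) (𝓝 0) := by
      have : ContinuousAt (fun x : ℝ => r / α * x ^ (1 - α)) 0 :=
        (Real.continuousAt_rpow_const _ _ (Or.inr (by linarith))).const_mul _
      have h := this.tendsto.mono_left (nhdsWithin_le_nhds (s := Ioi 0))
      rwa [Real.zero_rpow (by linarith), mul_zero] at h
    refine squeeze_zero_norm' ?_ hlim
    filter_upwards [self_mem_nhdsWithin] with x hx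
    have hx : 0 < x := hx
    obtain ⟨h1, h2⟩ := exp_sub_exp_bounds (β := β) hr hx.le
    have h3 := Real.rpow_nonneg hx.le (-α)
    have h4 : x ^ (1 - α) = x ^ (-α) * x := by
      rw [← Real.rpow_add_one hx.ne']; ring_nf
    have h5 : Real.exp (-β * x) ≤ 1 := Real.exp_le_one_iff.2 (by nlinarith)
    have h6 : Real.exp (-β * x) - Real.exp (-(β + r) * x) ≤ r * x :=
      h2.trans (mul_le_of_le_one_right (by positivity) h5)
    simp only [Pi.mul_apply]
    rw [norm_mul, norm_mul, norm_neg, Real.norm_of_nonneg h1, Real.norm_of_nonneg h3,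
      Real.norm_of_nonneg (by positivity : 0 ≤ 1 / α), h4]
    calc _ ≤ r * x * (1 / α * x ^ (-α)) := by gcongr
      _ = _ := by ring
  have hinf : Tendsto ((fun x => Real.exp (-β * x) - Real.exp (-(β + r) * x)) *
      fun x : ℝ => -(1 / α) * x ^ (-α)) atTop (𝓝 0) := by
    have he : ∀ γ : ℝ, 0 < γ → Tendsto (fun x => Real.exp (-γ * x)) atTop (𝓝 0) := fun γ hγ =>
      Real.tendsto_exp_atBot.comp (tendsto_id.const_mul_atTop_of_neg (by linarith))
    have h := ((he β hβ).sub (he (β + r) hβr)).mul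
      ((tendsto_rpow_neg_atTop hα0).const_mul (-(1 / α)))
    rw [sub_zero, mul_zero, mul_zero] at h
    exact h
  have key := integral_Ioi_mul_deriv_eq_deriv_mul hu hv huv' hu'v hzero hinf
  rw [key]
  have e : ∀ x : ℝ, (Real.exp (-β * x) * (-β * 1) - Real.exp (-(β + r) * x) * (-(β + r) * 1)) *
      (-(1 / α) * x ^ (-α)) = 1 / α * (β * (x ^ (-α) * Real.exp (-β * x))) -
        1 / α * ((β + r) * (x ^ (-α) * Real.exp (-(β + r) * x))) := fun x => by ring
  simp only [e]
  rw [integral_sub ((hint1.const_mul _).const_mul _) ((hint2.const_mul _).const_mul _)]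
  simp only [integral_const_mul]
  rw [hΓ β hβ, hΓ (β + r) hβr]
  ring

theorem integral_one_sub_exp_temperedStableMeasure {α β c r : ℝ} (hα0 : 0 < α) (hα1 : α < 1)
    (hβ : 0 < β) (hc : 0 < c) (hr : 0 ≤ r) :
    ∫ x, (1 - Real.exp (-r * x)) ∂(temperedStableMeasure α β c) =
      c * Real.Gamma (1 - α) / α * ((β + r) ^ α - β ^ α) := by
  rw [temperedStableMeasure, integral_withDensity_eq_integral_toReal_smul (by fun_prop)
    (.of_forall fun _ => ENNReal.ofReal_lt_top), mul_div_assoc, mul_assoc,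
    ← integral_exp_sub_exp_mul_rpow hα0 hα1 hβ hr, ← integral_const_mul]
  refine setIntegral_congr_fun measurableSet_Ioi fun x hx => ?_
  have hx : 0 < x := hx
  have h1 := Real.rpow_nonneg hx.le (1 + α)
  have h2 : Real.exp (-(β + r) * x) = Real.exp (-β * x) * Real.exp (-r * x) := by
    rw [← Real.exp_add]; ring_nf
  have h3 : x ^ (-1 - α) = (x ^ (1 + α))⁻¹ := by
    rw [← Real.rpow_neg hx.le]; ring_nf
  simp only [smul_eq_mul]
  rw [ENNReal.toReal_ofReal (by positivity), h2, h3]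
  ring

/-! ### The logarithmic characteristic as a time integral -/

/-- The substitution `z = β exp (2 b (t - s))`. -/
theorem integral_rpow_add_mul_exp {α β b q : ℝ} (hβ : 0 < β) (hb : 0 < b) (hq : 0 ≤ q) (t : ℝ) :
    ∫ s in (0 : ℝ)..t, (β + q * Real.exp (-2 * b * (t - s))) ^ α =
      β ^ α / (2 * b) *
        ∫ z in β..(β / Real.exp (-2 * b * t)), z ^ (-1 - α) * (z + q) ^ α := by
  rw [intervalIntegral.integral_comp_sub_left (fun s => (β + q * Real.exp (-2 * b * s)) ^ α) t,
    sub_self, sub_zero]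
  have hd : ∀ s ∈ uIcc (0 : ℝ) t, HasDerivAt (fun s => β * Real.exp (2 * b * s))
      (β * (Real.exp (2 * b * s) * (2 * b * 1))) s := fun s _ =>
    (((hasDerivAt_id s).const_mul (2 * b)).exp).const_mul β
  have h := intervalIntegral.integral_comp_mul_deriv' (g := fun z => z ^ (-1 - α) * (z + q) ^ α)
    hd (by fun_prop) (by
      rintro z ⟨s, -, rfl⟩
      have : 0 < β * Real.exp (2 * b * s) := by positivity
      exact ((Real.continuousAt_rpow_const _ _ (Or.inl this.ne')).mul
        ((continuousAt_id.add continuousAt_const).rpow_const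
          (Or.inl (ne_of_gt (add_pos_of_pos_of_nonneg this hq))))).continuousWithinAt)
  have e : β / Real.exp (-2 * b * t) = β * Real.exp (2 * b * t) := by
    rw [div_eq_mul_inv, ← Real.exp_neg]; ring_nf
  simp only [mul_zero, Real.exp_zero, mul_one] at h
  rw [e, ← h, ← intervalIntegral.integral_const_mul]
  refine intervalIntegral.integral_congr fun s _ => ?_
  simp only [Function.comp_apply]
  have hE : 0 < Real.exp (2 * b * s) := Real.exp_pos _
  have e1 : β + q * Real.exp (-2 * b * s) =
      (β * Real.exp (2 * b * s) + q) * (Real.exp (2 * b * s))⁻¹ := by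
    rw [show -2 * b * s = -(2 * b * s) by ring, Real.exp_neg]
    field_simp
  rw [e1, Real.mul_rpow (by positivity) (by positivity), Real.inv_rpow hE.le,
    Real.mul_rpow hβ.le hE.le, show -1 - α = -(1 + α) by ring, Real.rpow_neg hβ.le,
    Real.rpow_neg hE.le, Real.rpow_add hβ, Real.rpow_add hE, Real.rpow_one, Real.rpow_one]
  have h1 := Real.rpow_pos_of_pos hβ α
  have h2 := Real.rpow_pos_of_pos hE α
  field_simp

theorem neg_integral_laplaceExponent {α β b K q : ℝ} (hβ : 0 < β) (hb : 0 < b)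
    (hq : 0 ≤ q) (t : ℝ) :
    -∫ s in (0 : ℝ)..t, K * ((β + q * Real.exp (-2 * b * (t - s))) ^ α - β ^ α) =
      -(K * β ^ α / (2 * b)) *
        ((∫ z in β..(β / Real.exp (-2 * b * t)), z ^ (-1 - α) * (z + q) ^ α)
          + Real.log (Real.exp (-2 * b * t))) := by
  have hc : Continuous fun s => (β + q * Real.exp (-2 * b * (t - s))) ^ α :=
    Continuous.rpow_const (by fun_prop) fun s => Or.inl (by positivity)
  rw [intervalIntegral.integral_const_mul, intervalIntegral.integral_sub
    (hc.intervalIntegrable _ _) intervalIntegrable_const, integral_rpow_add_mul_exp hβ hb hq,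
    intervalIntegral.integral_const, Real.log_exp, smul_eq_mul]
  field_simp
  ring

theorem continuous_integral_laplaceExponent {α β b K σ : ℝ} (hβ : 0 < β) (t : ℝ) :
    Continuous fun u : ℝ => -∫ s in (0 : ℝ)..t,
      K * ((β + σ ^ 2 * u ^ 2 / 2 * Real.exp (-2 * b * (t - s))) ^ α - β ^ α) := by
  refine (intervalIntegral.continuous_parametric_intervalIntegral_of_continuous' ?_ 0 t).neg
  refine ((Continuous.rpow_const (by fun_prop) fun p => Or.inl ?_).sub
    continuous_const).const_mul K
  positivity

/-! ### Riemann–Stieltjes sums of paths with countably many discontinuities -/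

theorem exists_mem_Ioc_partition {τ : ℕ → ℝ≥0} {n : ℕ} (h0 : τ 0 = 0) {s : ℝ≥0} (hs0 : 0 < s)
    (hs : s ≤ τ n) : ∃ i < n, s ∈ Ioc (τ i) (τ (i + 1)) := by
  classical
  have hex : ∃ j, s ≤ τ j := ⟨n, hs⟩
  have hne : Nat.find hex ≠ 0 := fun h => by
    have := Nat.find_spec hex
    rw [h, h0] at this
    exact hs0.not_ge this
  obtain ⟨i, hi⟩ := Nat.exists_eq_succ_of_ne_zero hne
  refine ⟨i, ?_, ?_, ?_⟩
  · have := Nat.find_min' hex hs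
    omega
  · exact not_le.1 (Nat.find_min hex (by omega))
  · have := Nat.find_spec hex
    rwa [hi] at this

/-- Tagged Riemann sums of a bounded function with countably many discontinuities converge: as the
mesh tends to zero the step functions with values `y (ξ i)` converge to `y` off a countable set. -/
theorem tendsto_sum_mul_integral_partition {y : ℝ≥0 → ℝ} {φ : ℝ → ℝ} (hφ : Continuous φ) {t : ℝ≥0}
    {M : ℝ} (hM : ∀ s ≤ t, |y s| ≤ M) (hy : {s | ¬ContinuousAt y s}.Countable)
    {n : ℕ → ℕ} {τ ξ : ℕ → ℕ → ℝ≥0} (hτ : ∀ k, Monotone (τ k) ∧ τ k 0 = 0 ∧ τ k (n k) = t)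
    (hmesh : ∀ ε : ℝ, 0 < ε → ∀ᶠ k in atTop, ∀ i < n k, (τ k (i + 1) : ℝ) - τ k i < ε)
    (hξ : ∀ k i, ξ k i ∈ Icc (τ k i) (τ k (i + 1))) :
    Tendsto (fun k => ∑ i ∈ Finset.range (n k),
        y (ξ k i) * ∫ s in (τ k i : ℝ)..(τ k (i + 1)), φ s) atTop
      (𝓝 (∫ s in (0 : ℝ)..t, y s.toNNReal * φ s)) := by
  set F : ℕ → ℝ → ℝ := fun k s => ∑ i ∈ Finset.range (n k),
    (Ioc (τ k i : ℝ) (τ k (i + 1))).indicator (fun s => y (ξ k i) * φ s) s with hF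
  have hle : ∀ k i, (τ k i : ℝ) ≤ τ k (i + 1) := fun k i => (hτ k).1 i.le_succ
  have hsum : ∀ k, ∑ i ∈ Finset.range (n k), y (ξ k i) * ∫ s in (τ k i : ℝ)..(τ k (i + 1)), φ s =
      ∫ s in Ioc (0 : ℝ) t, F k s := by
    intro k
    simp only [hF]
    rw [integral_finsetSum]
    · refine Finset.sum_congr rfl fun i hi => ?_
      have hi : i + 1 ≤ n k := Finset.mem_range.1 hi
      rw [setIntegral_indicator measurableSet_Ioc, ← intervalIntegral.integral_const_mul,
        intervalIntegral.integral_of_le (hle k i), inter_eq_right.2]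
      refine Ioc_subset_Ioc (τ k i).coe_nonneg ?_
      rw [← (hτ k).2.2]
      exact (hτ k).1 hi
    · intro i _
      refine Integrable.indicator ?_ measurableSet_Ioc
      exact (hφ.const_mul _).integrableOn_Ioc
  have hval : ∀ k, ∀ s ∈ Ioc (0 : ℝ) t, ∃ i < n k, s ∈ Ioc (τ k i : ℝ) (τ k (i + 1)) ∧
      F k s = y (ξ k i) * φ s := by
    intro k s hs
    obtain ⟨i, hi, h1, h2⟩ := exists_mem_Ioc_partition (hτ k).2.1 (Real.toNNReal_pos.2 hs.1)
      (by rw [(hτ k).2.2]; exact Real.toNNReal_le_iff_le_coe.2 hs.2 : s.toNNReal ≤ τ k (n k))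
    have h1' : (τ k i : ℝ) < s := Real.lt_toNNReal_iff_coe_lt.1 h1
    have h2' : s ≤ τ k (i + 1) := Real.toNNReal_le_iff_le_coe.1 h2
    refine ⟨i, hi, ⟨h1', h2'⟩, ?_⟩
    simp only [hF]
    have hs' : s ∈ Ioc (τ k i : ℝ) (τ k (i + 1)) := ⟨h1', h2'⟩
    rw [Finset.sum_eq_single_of_mem i (Finset.mem_range.2 hi), indicator_of_mem hs']
    intro j _ hj
    refine indicator_of_notMem (fun hmem => ?_) _
    have hmono : Monotone fun i => (τ k i : ℝ) := fun a b hab => (hτ k).1 hab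
    exact disjoint_left.1 (hmono.pairwise_disjoint_on_Ioc_succ hj) hmem ⟨h1', h2'⟩
  have htag : ∀ k i, i < n k → ξ k i ≤ t := fun k i hi =>
    (hξ k i).2.trans (by rw [← (hτ k).2.2]; exact (hτ k).1 hi)
  simp only [hsum]
  rw [intervalIntegral.integral_of_le t.coe_nonneg]
  refine tendsto_integral_of_dominated_convergence (fun s => M * |φ s|) ?_ ?_ ?_ ?_
  · intro k
    refine Measurable.aestronglyMeasurable (Finset.measurable_fun_sum _ fun i _ => ?_)
    exact (hφ.measurable.const_mul _).indicator measurableSet_Ioc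
  · exact (continuous_const.mul hφ.abs).integrableOn_Ioc
  · intro k
    refine (ae_restrict_iff' measurableSet_Ioc).2 (.of_forall fun s hs => ?_)
    obtain ⟨i, hi, -, h⟩ := hval k s hs
    rw [h, norm_mul, Real.norm_eq_abs, Real.norm_eq_abs]
    exact mul_le_mul_of_nonneg_right (hM _ (htag k i hi)) (abs_nonneg _)
  · have hcount : ((fun x : ℝ≥0 => (x : ℝ)) '' {s | ¬ContinuousAt y s}).Countable := hy.image _
    refine (ae_restrict_iff' measurableSet_Ioc).2
      ((hcount.ae_notMem volume).mono fun s hs hst => ?_)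
    have hcont : ContinuousAt y s.toNNReal := by
      by_contra hcon
      exact hs ⟨s.toNNReal, hcon, Real.coe_toNNReal s hst.1.le⟩
    choose i hi hmem hFi using fun k => hval k s hst
    simp only [hFi]
    refine (hcont.tendsto.comp ?_).mul_const _
    rw [← NNReal.tendsto_coe, Real.coe_toNNReal s hst.1.le, Metric.tendsto_atTop']
    intro ε hε
    obtain ⟨N, hN⟩ := eventually_atTop.1 (hmesh ε hε)
    refine ⟨N, fun k hk => ?_⟩
    have h1 := hN k hk.le (i k) (hi k)
    have h2 : (τ k (i k) : ℝ) ≤ ξ k (i k) := (hξ k (i k)).1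
    have h3 : (ξ k (i k) : ℝ) ≤ τ k (i k + 1) := (hξ k (i k)).2
    rw [Real.dist_eq, abs_lt]
    constructor <;> linarith [(hmem k).1, (hmem k).2]

/-- Summation by parts turns the Riemann–Stieltjes sums against `y` into Riemann sums of `y`, so
they converge although `y` need not have bounded variation. -/
theorem tendsto_riemannStieltjes_sum {y : ℝ≥0 → ℝ} {f f' : ℝ → ℝ}
    (hf : ∀ s, HasDerivAt f (f' s) s) (hf' : Continuous f') {t : ℝ≥0}
    {M : ℝ} (hM : ∀ s ≤ t, |y s| ≤ M) (hy : {s | ¬ContinuousAt y s}.Countable)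
    {n : ℕ → ℕ} {τ : ℕ → ℕ → ℝ≥0} (hτ : ∀ k, Monotone (τ k) ∧ τ k 0 = 0 ∧ τ k (n k) = t)
    (hmesh : ∀ ε : ℝ, 0 < ε → ∀ᶠ k in atTop, ∀ i < n k, (τ k (i + 1) : ℝ) - τ k i < ε) :
    Tendsto (fun k => ∑ i ∈ Finset.range (n k), f (τ k i) * (y (τ k (i + 1)) - y (τ k i))) atTop
      (𝓝 (f t * y t - f 0 * y 0 - ∫ s in (0 : ℝ)..t, y s.toNNReal * f' s)) := by
  have h := tendsto_sum_mul_integral_partition hf' hM hy hτ hmesh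
    (ξ := fun k i => τ k (i + 1)) fun k i => ⟨(hτ k).1 i.le_succ, le_rfl⟩
  refine (h.const_sub (f t * y t - f 0 * y 0)).congr fun k => ?_
  have hint : ∀ i, ∫ s in (τ k i : ℝ)..(τ k (i + 1)), f' s = f (τ k (i + 1)) - f (τ k i) :=
    fun i => intervalIntegral.integral_eq_sub_of_hasDerivAt (fun s _ => hf s)
      (hf'.intervalIntegrable _ _)
  have htel := Finset.sum_range_sub (fun i => f (τ k i) * y (τ k i)) (n k)
  simp only [(hτ k).2.1, (hτ k).2.2, NNReal.coe_zero] at htel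
  rw [← htel, ← Finset.sum_sub_distrib]
  refine Finset.sum_congr rfl fun i _ => ?_
  rw [hint]; ring

theorem tendsto_riemann_sum {G : ℝ → ℝ} (hG : Continuous G) {t : ℝ≥0}
    {n : ℕ → ℕ} {τ : ℕ → ℕ → ℝ≥0} (hτ : ∀ k, Monotone (τ k) ∧ τ k 0 = 0 ∧ τ k (n k) = t)
    (hmesh : ∀ ε : ℝ, 0 < ε → ∀ᶠ k in atTop, ∀ i < n k, (τ k (i + 1) : ℝ) - τ k i < ε) :
    Tendsto (fun k => ∑ i ∈ Finset.range (n k), G (τ k i) * ((τ k (i + 1) : ℝ) - τ k i)) atTop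
      (𝓝 (∫ s in (0 : ℝ)..t, G s)) := by
  have hcont : Continuous fun s : ℝ≥0 => G s := hG.comp NNReal.continuous_coe
  obtain ⟨M, hM⟩ := (isCompact_Icc (a := (0 : ℝ≥0)) (b := t)).exists_bound_of_continuousOn
    hcont.continuousOn
  have h := tendsto_sum_mul_integral_partition (φ := fun _ => 1) continuous_const (t := t)
    (fun s hs => hM s ⟨zero_le, hs⟩) (by simp [hcont.continuousAt]) hτ hmesh
    (ξ := fun k i => τ k i) fun k i => ⟨le_rfl, (hτ k).1 i.le_succ⟩
  simp only [intervalIntegral.integral_const, smul_eq_mul, mul_one] at h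
  convert! h using 2
  refine intervalIntegral.integral_congr fun s hs => ?_
  rw [uIcc_of_le t.coe_nonneg] at hs
  simp only [Real.coe_toNNReal s hs.1]

theorem exists_uniform_partition (t : ℝ≥0) : ∃ (n : ℕ → ℕ) (τ : ℕ → ℕ → ℝ≥0),
    (∀ k, Monotone (τ k) ∧ τ k 0 = 0 ∧ τ k (n k) = t) ∧
    ∀ ε : ℝ, 0 < ε → ∀ᶠ k in atTop, ∀ i < n k, (τ k (i + 1) : ℝ) - τ k i < ε := by
  refine ⟨fun k => k + 1, fun k i => t * i / (k + 1 : ℕ), fun k => ⟨fun i j hij => ?_, ?_, ?_⟩,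
    fun ε hε => ?_⟩
  · simp only; gcongr
  · simp
  · simp only; field_simp
  · have h : Tendsto (fun k : ℕ => (t : ℝ) * (1 / ((k : ℝ) + 1))) atTop (𝓝 ((t : ℝ) * 0)) :=
      tendsto_one_div_add_atTop_nhds_zero_nat.const_mul _
    rw [mul_zero] at h
    filter_upwards [h.eventually_lt_const hε] with k hk i _
    push_cast
    convert! hk using 1
    field_simp
    ring

/-! ### Increments of subordinated Brownian motion -/

section Increments

variable {Ω : Type*} [MeasurableSpace Ω] {P : Measure Ω}

theorem ProbabilityTheory.IsPreBrownianReal.integral_cexp_sum_increments [IsProbabilityMeasure P]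
    {W : ℝ≥0 → Ω → ℝ} (hW : IsPreBrownianReal W P) {n : ℕ} {r : Fin (n + 1) → ℝ≥0}
    (hr : Monotone r) (v : Fin n → ℝ) :
    ∫ ω, Complex.exp ((∑ j, v j * (W (r j.succ) ω - W (r j.castSucc) ω) : ℝ) * Complex.I) ∂P =
      (Real.exp (-∑ j, v j ^ 2 / 2 * ((r j.succ : ℝ) - r j.castSucc)) : ℝ) := by
  have hmeas : ∀ j : Fin n, AEMeasurable (fun ω => W (r j.succ) ω - W (r j.castSucc) ω) P :=
    fun j => (hW.aemeasurable _).sub (hW.aemeasurable _)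
  have h := iIndepFun.integral_fun_prod_comp 
    (X := fun j ω => W (r j.succ) ω - W (r j.castSucc) ω) (hW.hasIndepIncrements n r hr) hmeas
    (f := fun j x => Complex.exp (v j * x * Complex.I))
    (fun j => (Measurable.aestronglyMeasurable (by fun_prop)))
  have e : ∀ ω, Complex.exp ((∑ j, v j * (W (r j.succ) ω - W (r j.castSucc) ω) : ℝ) * Complex.I) =
      ∏ j, Complex.exp (v j * ((W (r j.succ) ω - W (r j.castSucc) ω : ℝ) : ℂ) * Complex.I) := by
    intro ω
    rw [← Complex.exp_sum, ← Finset.sum_mul]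
    push_cast; rfl
  simp only [e]
  rw [h, ← Finset.sum_neg_distrib, Real.exp_sum, Complex.ofReal_prod]
  refine Finset.prod_congr rfl fun j _ => ?_
  have hle : r j.castSucc ≤ r j.succ := hr j.castSucc_lt_succ.le
  obtain ⟨d, hd, hlaw⟩ : ∃ d : ℝ≥0, (d : ℝ) = (r j.succ : ℝ) - r j.castSucc ∧
      P.map (fun ω => W (r j.succ) ω - W (r j.castSucc) ω) = gaussianReal 0 d :=
    ⟨_, by rw [coe_nndist, Real.dist_eq]; exact abs_of_nonneg (sub_nonneg.2 hle),
      (hW.hasLaw_sub (r j.succ) (r j.castSucc)).map_eq⟩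
  have hc := charFun_gaussianReal (μ := 0) (v := d) (v j)
  rw [← hlaw, charFun_apply_real, integral_map (hmeas j)
    (Measurable.aestronglyMeasurable (by fun_prop))] at hc
  rw [hd] at hc
  refine Eq.trans hc ?_
  push_cast
  congr 1
  ring

/-- For independent `K` and `X`, the expectation of `g (K, X)` is obtained by first averaging over
an independent copy of `X`. -/
theorem integral_of_indepFun [IsProbabilityMeasure P] {𝓚 𝓧 : Type*} [MeasurableSpace 𝓚]
    [MeasurableSpace 𝓧] {K : Ω → 𝓚} {X : Ω → 𝓧} (hK : AEMeasurable K P) (hX : AEMeasurable X P)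
    (hKX : IndepFun K X P) {g : 𝓚 × 𝓧 → ℂ} (hg : Measurable g) (hg1 : ∀ p, ‖g p‖ ≤ 1) :
    ∫ ω, g (K ω, X ω) ∂P = ∫ ω, ∫ ω', g (K ω, X ω') ∂P ∂P := by
  have := Measure.isProbabilityMeasure_map hK
  have := Measure.isProbabilityMeasure_map hX
  have hmap := (indepFun_iff_map_prod_eq_prod_map_map hK hX).1 hKX
  rw [← integral_map (φ := fun ω => (K ω, X ω)) (hK.prodMk hX) hg.aestronglyMeasurable, hmap,
    integral_prod _ (Integrable.of_bound hg.aestronglyMeasurable 1 (.of_forall hg1)),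
    integral_map hK]
  · refine integral_congr_ae (.of_forall fun ω => ?_)
    exact integral_map hX (hg.comp measurable_prodMk_left).aestronglyMeasurable
  · exact (hg.stronglyMeasurable.integral_prod_right' (ν := P.map X)).aestronglyMeasurable

/-- `x` rounded down to a multiple of `1 / (m + 1)`. -/
noncomputable def gridFloor (m : ℕ) (x : ℝ≥0) : ℝ≥0 := (⌊((m : ℝ) + 1) * x⌋₊ : ℝ≥0) / (m + 1)

theorem gridFloor_mono (m : ℕ) : Monotone (gridFloor m) := by
  intro x y hxy
  unfold gridFloor
  gcongr

theorem tendsto_gridFloor (x : ℝ≥0) : Tendsto (fun m => gridFloor m x) atTop (𝓝 x) := by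
  rw [← NNReal.tendsto_coe]
  have h := (tendsto_nat_floor_mul_div_atTop (R := ℝ) x.coe_nonneg).comp
    (tendsto_atTop_add_const_right atTop (1 : ℝ) tendsto_natCast_atTop_atTop)
  refine h.congr fun m => ?_
  simp [gridFloor, mul_comm]

section Subordination

variable {W : ℝ≥0 → Ω → ℝ} {L : ℝ≥0 → Ω → ℝ≥0}

theorem aemeasurable_comp_gridFloor (hW : IsBrownianReal W P) (hL : ∀ t, AEMeasurable (L t) P)
    (m : ℕ) (t : ℝ≥0) : AEMeasurable (fun ω => W (gridFloor m (L t ω)) ω) P := by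
  have hX : AEMeasurable (fun ω (k : ℕ) => W ((k : ℝ≥0) / (m + 1)) ω) P :=
    aemeasurable_pi_lambda _ fun k => hW.aemeasurable _
  have hK : AEMeasurable (fun ω => ⌊((m : ℝ) + 1) * L t ω⌋₊) P :=
    Nat.measurable_floor.comp_aemeasurable ((hL t).coe_nnreal_real.const_mul _)
  have hg : Measurable fun p : ℕ × (ℕ → ℝ) => p.2 p.1 :=
    measurable_from_prod_countable_right fun k => measurable_pi_apply k
  exact hg.comp_aemeasurable (hK.prodMk hX)

theorem aemeasurable_comp_subordinator (hW : IsBrownianReal W P)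
    (hL : ∀ t, AEMeasurable (L t) P) (t : ℝ≥0) : AEMeasurable (fun ω => W (L t ω) ω) P := by
  refine aemeasurable_of_tendsto_metrizable_ae atTop
    (fun m => aemeasurable_comp_gridFloor hW hL m t) ?_
  filter_upwards [hW.cont] with ω hω
  exact (hω.tendsto _).comp (tendsto_gridFloor _)

theorem integral_cexp_sum_gridFloor [IsProbabilityMeasure P] (hW : IsBrownianReal W P)
    (hL : ∀ t, AEMeasurable (L t) P) (hmono : ∀ᵐ ω ∂P, Monotone fun t => L t ω)
    (hWL : IndepFun (fun ω s => W s ω) (fun ω s => L s ω) P) (m : ℕ) {n : ℕ}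
    {τ : Fin (n + 1) → ℝ≥0} (hτ : Monotone τ) (v : Fin n → ℝ) :
    ∫ ω, Complex.exp ((∑ j, v j * (W (gridFloor m (L (τ j.succ) ω)) ω -
        W (gridFloor m (L (τ j.castSucc) ω)) ω) : ℝ) * Complex.I) ∂P =
      ∫ ω, ((Real.exp (-∑ j, v j ^ 2 / 2 *
        ((gridFloor m (L (τ j.succ) ω) : ℝ) - gridFloor m (L (τ j.castSucc) ω))) : ℝ) : ℂ) ∂P := by
  set X : Ω → ℕ → ℝ := fun ω k => W ((k : ℝ≥0) / (m + 1)) ω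
  set K : Ω → Fin (n + 1) → ℕ := fun ω j => ⌊((m : ℝ) + 1) * L (τ j) ω⌋₊
  have hX : AEMeasurable X P := aemeasurable_pi_lambda _ fun k => hW.aemeasurable _
  have hK : AEMeasurable K P := aemeasurable_pi_lambda _ fun j =>
    Nat.measurable_floor.comp_aemeasurable ((hL _).coe_nnreal_real.const_mul _)
  have hKX : IndepFun K X P := by
    refine (hWL.comp (φ := fun w (k : ℕ) => w ((k : ℝ≥0) / (m + 1)))
      (ψ := fun l (j : Fin (n + 1)) => ⌊((m : ℝ) + 1) * l (τ j)⌋₊) ?_ ?_).symm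
    · exact measurable_pi_lambda _ fun k => measurable_pi_apply _
    · exact measurable_pi_lambda _ fun j => Nat.measurable_floor.comp
        ((measurable_pi_apply (τ j)).coe_nnreal_real.const_mul _)
  set g : (Fin (n + 1) → ℕ) × (ℕ → ℝ) → ℂ := fun p =>
    Complex.exp ((∑ j, v j * (p.2 (p.1 (Fin.succ j)) - p.2 (p.1 (Fin.castSucc j))) : ℝ) * Complex.I)
  have hg : Measurable g := measurable_from_prod_countable_right fun k => by
    simp only [g]
    fun_prop
  have hg1 : ∀ p, ‖g p‖ ≤ 1 := fun p => (Complex.norm_exp_ofReal_mul_I _).le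
  refine (integral_of_indepFun hK hX hKX hg hg1).trans (integral_congr_ae ?_)
  filter_upwards [hmono] with ω hω
  exact hW.integral_cexp_sum_increments (r := fun j => gridFloor m (L (τ j) ω))
    (fun i j hij => gridFloor_mono m (hω (hτ hij))) v

/-- Conditionally on the subordinator, the increments of the subordinated Brownian motion are
independent centred Gaussians whose variances are the increments of the subordinator. Rounding the
subordinator to a grid reduces the conditioning to countably many values; path continuity
removes the rounding. -/
theorem integral_cexp_sum_subordinated [IsProbabilityMeasure P] (hW : IsBrownianReal W P)
    (hL : ∀ t, AEMeasurable (L t) P) (hmono : ∀ᵐ ω ∂P, Monotone fun t => L t ω)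
    (hWL : IndepFun (fun ω s => W s ω) (fun ω s => L s ω) P) {n : ℕ}
    {τ : Fin (n + 1) → ℝ≥0} (hτ : Monotone τ) (v : Fin n → ℝ) :
    ∫ ω, Complex.exp ((∑ j, v j * (W (L (τ j.succ) ω) ω - W (L (τ j.castSucc) ω) ω) : ℝ) *
        Complex.I) ∂P =
      ∫ ω, ((Real.exp (-∑ j, v j ^ 2 / 2 *
        ((L (τ j.succ) ω : ℝ) - L (τ j.castSucc) ω)) : ℝ) : ℂ) ∂P := by
  have hgm : ∀ m t, AEMeasurable (fun ω => gridFloor m (L t ω)) P := fun m t =>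
    (gridFloor_mono m).measurable.comp_aemeasurable (hL t)
  have hc1 : Continuous fun x : ℝ => Complex.exp (x * Complex.I) := by fun_prop
  have hc2 : Continuous fun x : ℝ => ((Real.exp (-x) : ℝ) : ℂ) := by fun_prop
  have h1 : Tendsto (fun m => ∫ ω, Complex.exp ((∑ j, v j * (W (gridFloor m (L (τ j.succ) ω)) ω -
        W (gridFloor m (L (τ j.castSucc) ω)) ω) : ℝ) * Complex.I) ∂P) atTop
      (𝓝 (∫ ω, Complex.exp ((∑ j, v j *
        (W (L (τ j.succ) ω) ω - W (L (τ j.castSucc) ω) ω) : ℝ) * Complex.I) ∂P)) := by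
    refine tendsto_integral_of_dominated_convergence (fun _ => 1) (fun m => ?_)
      (integrable_const _) (fun m => .of_forall fun ω => (Complex.norm_exp_ofReal_mul_I _).le) ?_
    · refine (hc1.measurable.comp_aemeasurable
        (Finset.aemeasurable_fun_sum _ fun j _ => ?_)).aestronglyMeasurable
      exact ((aemeasurable_comp_gridFloor hW hL m _).sub
        (aemeasurable_comp_gridFloor hW hL m _)).const_mul _
    · filter_upwards [hW.cont] with ω hω
      have h : ∀ t, Tendsto (fun m => W (gridFloor m (L t ω)) ω) atTop (𝓝 (W (L t ω) ω)) :=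
        fun t => (hω.tendsto _).comp (tendsto_gridFloor _)
      exact (hc1.tendsto _).comp (tendsto_finsetSum _ fun j _ => ((h _).sub (h _)).const_mul _)
  have h2 : Tendsto (fun m => ∫ ω, ((Real.exp (-∑ j, v j ^ 2 / 2 *
        ((gridFloor m (L (τ j.succ) ω) : ℝ) - gridFloor m (L (τ j.castSucc) ω))) : ℝ) : ℂ) ∂P) atTop
      (𝓝 (∫ ω, ((Real.exp (-∑ j, v j ^ 2 / 2 *
        ((L (τ j.succ) ω : ℝ) - L (τ j.castSucc) ω)) : ℝ) : ℂ) ∂P)) := by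
    refine tendsto_integral_of_dominated_convergence (fun _ => 1) (fun m => ?_)
      (integrable_const _) (fun m => ?_) (.of_forall fun ω => ?_)
    · refine (hc2.measurable.comp_aemeasurable
        (Finset.aemeasurable_fun_sum _ fun j _ => ?_)).aestronglyMeasurable
      exact ((hgm m _).coe_nnreal_real.sub (hgm m _).coe_nnreal_real).const_mul _
    · filter_upwards [hmono] with ω hω
      rw [Complex.norm_real, Real.norm_of_nonneg (Real.exp_nonneg _), Real.exp_le_one_iff,
        neg_nonpos]
      refine Finset.sum_nonneg fun j _ => mul_nonneg (by positivity) (sub_nonneg.2 ?_)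
      exact gridFloor_mono m (hω (hτ j.castSucc_lt_succ.le))
    · have h : ∀ t, Tendsto (fun m => ((gridFloor m (L t ω) : ℝ≥0) : ℝ)) atTop
          (𝓝 (L t ω : ℝ)) := fun t => NNReal.tendsto_coe.2 (tendsto_gridFloor _)
      exact (hc2.tendsto _).comp (tendsto_finsetSum _ fun j _ => ((h _).sub (h _)).const_mul _)
  simp only [integral_cexp_sum_gridFloor hW hL hmono hWL _ hτ v] at h1
  exact tendsto_nhds_unique h1 h2

theorem IsPureJumpSubordinator.integral_exp_sum_increments {ν : Measure ℝ}
    (hL : IsPureJumpSubordinator ν L P) {n : ℕ} {τ : Fin (n + 1) → ℝ≥0} (hτ : Monotone τ)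
    {r : Fin n → ℝ} (hr : ∀ j, 0 ≤ r j) :
    ∫ ω, Real.exp (-∑ j, r j * ((L (τ j.succ) ω : ℝ) - L (τ j.castSucc) ω)) ∂P =
      Real.exp (-∑ j, ((τ j.succ : ℝ) - τ j.castSucc) * ∫ x, (1 - Real.exp (-r j * x)) ∂ν) := by
  have hmeas : ∀ j : Fin n, AEMeasurable (fun ω => (L (τ j.succ) ω : ℝ) - L (τ j.castSucc) ω) P :=
    fun j => (hL.aemeasurable _).coe_nnreal_real.sub (hL.aemeasurable _).coe_nnreal_real
  have h := iIndepFun.integral_fun_prod_comp (hL.indep n τ hτ) hmeas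
    (f := fun j x => Real.exp (-r j * x))
    (fun j => (Measurable.aestronglyMeasurable (by fun_prop)))
  simp only [← Finset.sum_neg_distrib, Real.exp_sum]
  simp only [neg_mul] at h ⊢
  refine h.trans (Finset.prod_congr rfl fun j _ => ?_)
  have hle : τ j.castSucc ≤ τ j.succ := hτ j.castSucc_lt_succ.le
  have hst := hL.stationary (τ j.castSucc) (τ j.succ - τ j.castSucc)
  rw [add_tsub_cancel_of_le hle] at hst
  have hid := (hst.comp (u := fun x => Real.exp (-r j * x)) (by fun_prop)).integral_eq
  have hlap := hL.laplace (τ j.succ - τ j.castSucc) (r j) (hr j)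
  simp only [Function.comp_def, neg_mul] at hid hlap
  rw [hid, hlap, NNReal.coe_sub hle]

end Subordination

end Increments

/-! ### The Ornstein–Uhlenbeck integral -/

section OrnsteinUhlenbeck

variable {Ω : Type*} [MeasurableSpace Ω] {P : Measure Ω} {W : ℝ≥0 → Ω → ℝ} {L : ℝ≥0 → Ω → ℝ≥0}

theorem aemeasurable_subordinated (hW : IsBrownianReal W P) (hL : ∀ t, AEMeasurable (L t) P)
    (σ : ℝ) (t : ℝ≥0) : AEMeasurable (subordinated σ W L t) P :=
  (aemeasurable_comp_subordinator hW hL t).const_mul σ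

theorem aemeasurable_riemannStieltjes_sum {Y : ℝ≥0 → Ω → ℝ} (hY : ∀ t, AEMeasurable (Y t) P)
    (f : ℝ → ℝ) (τ : ℕ → ℝ≥0) (n : ℕ) :
    AEMeasurable (fun ω => ∑ i ∈ Finset.range n, f (τ i) * (Y (τ (i + 1)) ω - Y (τ i) ω)) P :=
  Finset.aemeasurable_fun_sum _ fun _ _ => ((hY _).sub (hY _)).const_mul _

/-- The paths `s ↦ W (L s)` are bounded on compacts and are discontinuous at most where the monotone
path of `L` is, so the Riemann–Stieltjes sums converge path by path. -/
theorem exists_isStochIntegral_subordinated [IsFiniteMeasure P] (hW : IsBrownianReal W P)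
    (hL : ∀ t, AEMeasurable (L t) P) (hmono : ∀ᵐ ω ∂P, Monotone fun t => L t ω) (σ : ℝ)
    {f f' : ℝ → ℝ} (hf : ∀ s, HasDerivAt f (f' s) s) (hf' : Continuous f') (t : ℝ≥0) :
    ∃ Z : Ω → ℝ, IsStochIntegral P f (subordinated σ W L) t Z := by
  refine ⟨fun ω => f t * subordinated σ W L t ω - f 0 * subordinated σ W L 0 ω -
    ∫ s in (0 : ℝ)..t, subordinated σ W L s.toNNReal ω * f' s, fun n τ hτ hmesh => ?_⟩
  refine tendstoInMeasure_of_tendsto_ae (fun k => (aemeasurable_riemannStieltjes_sum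
    (fun t => aemeasurable_subordinated hW hL σ t) f (τ k) (n k)).aestronglyMeasurable) ?_
  filter_upwards [hW.cont, hmono] with ω hWω hLω
  have hcont : Continuous fun x => σ * W x ω := hWω.const_mul σ
  obtain ⟨M, hM⟩ := (isCompact_Icc (a := (0 : ℝ≥0)) (b := L t ω)).exists_bound_of_continuousOn
    hcont.continuousOn
  have hdisc : {s | ¬ContinuousAt (fun s => subordinated σ W L s ω) s}.Countable :=
    hLω.countable_not_continuousAt.mono fun s hs hc =>
      hs (ContinuousAt.comp (g := fun x => σ * W x ω) hcont.continuousAt hc)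
  exact tendsto_riemannStieltjes_sum (y := fun s => subordinated σ W L s ω) hf hf'
    (fun s hs => hM _ ⟨zero_le, hLω hs⟩) hdisc hτ hmesh

theorem integral_cexp_riemannStieltjes_sum [IsProbabilityMeasure P] {ν : Measure ℝ}
    (hW : IsBrownianReal W P) (hL : IsPureJumpSubordinator ν L P)
    (hWL : IndepFun (fun ω s => W s ω) (fun ω s => L s ω) P) (σ u : ℝ) (f : ℝ → ℝ)
    {τ : ℕ → ℝ≥0} (hτ : Monotone τ) (n : ℕ) :
    ∫ ω, Complex.exp (u * (∑ i ∈ Finset.range n,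
        f (τ i) * (subordinated σ W L (τ (i + 1)) ω - subordinated σ W L (τ i) ω) : ℝ) *
        Complex.I) ∂P =
      (Real.exp (-∑ i ∈ Finset.range n, (∫ x, (1 - Real.exp
        (-(σ ^ 2 * u ^ 2 / 2 * f (τ i) ^ 2) * x)) ∂ν) * ((τ (i + 1) : ℝ) - τ i)) : ℝ) := by
  have hτ' : Monotone fun j : Fin (n + 1) => τ j := fun i j hij => hτ hij
  have h1 := integral_cexp_sum_subordinated hW hL.aemeasurable hL.mono hWL hτ'
    fun j => u * (f (τ j) * σ)
  have h2 := hL.integral_exp_sum_increments hτ' (r := fun j => (u * (f (τ j) * σ)) ^ 2 / 2)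
    fun j => by positivity
  rw [integral_complex_ofReal, h2] at h1
  convert! h1 using 1
  · refine integral_congr_ae (.of_forall fun ω => ?_)
    simp only
    rw [← Complex.ofReal_mul, Finset.mul_sum, Finset.sum_range]
    congr 3
    refine Finset.sum_congr rfl fun j _ => ?_
    simp only [subordinated, Fin.val_succ, Fin.val_castSucc]
    ring
  · rw [Finset.sum_range]
    congr 3
    refine Finset.sum_congr rfl fun j _ => ?_
    simp only [Fin.val_succ, Fin.val_castSucc]
    rw [mul_comm, show (u * (f (τ j) * σ)) ^ 2 / 2 = σ ^ 2 * u ^ 2 / 2 * f (τ j) ^ 2 by ring]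

theorem aemeasurable_of_isStochIntegral {Y : ℝ≥0 → Ω → ℝ} (hY : ∀ t, AEMeasurable (Y t) P)
    {f : ℝ → ℝ} {t : ℝ≥0} {Z : Ω → ℝ} (hZ : IsStochIntegral P f Y t Z) : AEMeasurable Z P := by
  obtain ⟨n, τ, hτ, hmesh⟩ := exists_uniform_partition t
  obtain ⟨ns, -, hns⟩ := (hZ n τ hτ hmesh).exists_seq_tendsto_ae
  exact aemeasurable_of_tendsto_metrizable_ae atTop
    (fun k => aemeasurable_riemannStieltjes_sum hY f (τ (ns k)) (n (ns k))) hns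

/-- The characteristic function of `∫₀ᵗ f dY` is `exp (-∫₀ᵗ Φ (σ² u² f(s)² / 2) ds)`, where `Φ` is
the Laplace exponent of the subordinator. -/
theorem charFun_of_isStochIntegral [IsProbabilityMeasure P] {ν : Measure ℝ}
    (hW : IsBrownianReal W P) (hL : IsPureJumpSubordinator ν L P)
    (hWL : IndepFun (fun ω s => W s ω) (fun ω s => L s ω) P) {σ : ℝ} {f : ℝ → ℝ} {t : ℝ≥0}
    {Z : Ω → ℝ} (hZ : IsStochIntegral P f (subordinated σ W L) t Z) (u : ℝ)
    (hc : Continuous fun s => ∫ x, (1 - Real.exp (-(σ ^ 2 * u ^ 2 / 2 * f s ^ 2) * x)) ∂ν) :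
    charFun (P.map Z) u = (Real.exp (-∫ s in (0 : ℝ)..t,
      ∫ x, (1 - Real.exp (-(σ ^ 2 * u ^ 2 / 2 * f s ^ 2) * x)) ∂ν) : ℝ) := by
  have hY := fun t => aemeasurable_subordinated hW hL.aemeasurable σ t
  have hZm := aemeasurable_of_isStochIntegral hY hZ
  obtain ⟨n, τ, hτ, hmesh⟩ := exists_uniform_partition t
  obtain ⟨ns, hmono, hns⟩ := (hZ n τ hτ hmesh).exists_seq_tendsto_ae
  have hcexp : Continuous fun x : ℝ => Complex.exp (u * x * Complex.I) := by fun_prop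
  have hexp : Continuous fun x : ℝ => ((Real.exp (-x) : ℝ) : ℂ) := by fun_prop
  rw [charFun_apply_real, integral_map hZm (Measurable.aestronglyMeasurable (by fun_prop))]
  have h1 : Tendsto (fun k => ∫ ω, Complex.exp (u * (∑ i ∈ Finset.range (n (ns k)),
      f (τ (ns k) i) * (subordinated σ W L (τ (ns k) (i + 1)) ω -
        subordinated σ W L (τ (ns k) i) ω) : ℝ) * Complex.I) ∂P) atTop
      (𝓝 (∫ ω, Complex.exp (u * Z ω * Complex.I) ∂P)) := by
    refine tendsto_integral_of_dominated_convergence (fun _ => 1) (fun k => ?_)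
      (integrable_const _) (fun k => .of_forall fun ω => ?_) ?_
    · exact (hcexp.measurable.comp_aemeasurable
        (aemeasurable_riemannStieltjes_sum hY f _ _)).aestronglyMeasurable
    · rw [← Complex.ofReal_mul, Complex.norm_exp_ofReal_mul_I]
    · filter_upwards [hns] with ω hω
      exact (hcexp.tendsto _).comp hω
  have h2 := (hexp.tendsto _).comp
    ((tendsto_riemann_sum hc hτ hmesh).comp hmono.tendsto_atTop)
  refine tendsto_nhds_unique h1 (h2.congr fun k => ?_)
  exact (integral_cexp_riemannStieltjes_sum hW hL hWL σ u f (hτ (ns k)).1 (n (ns k))).symm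

/-- The logarithmic characteristic of the Ornstein–Uhlenbeck integral of a normal tempered stable
process. -/
theorem isLogCharFun_of_isOUIntegral [IsProbabilityMeasure P] {α β c σ b : ℝ} (hα0 : 0 < α)
    (hα1 : α < 1) (hβ : 0 < β) (hc : 0 < c) (hb : 0 < b) (hW : IsBrownianReal W P)
    (hL : IsPureJumpSubordinator (temperedStableMeasure α β c) L P)
    (hWL : IndepFun (fun ω s => W s ω) (fun ω s => L s ω) P) {t : ℝ≥0} {Z : Ω → ℝ}
    (hZ : IsOUIntegral P b (subordinated σ W L) t Z) :
    IsLogCharFun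
      (fun u => ((-(c * β ^ α * Real.Gamma (1 - α) / (2 * α * b)) *
        (integralJ u σ α β (β / Real.exp (-2 * b * t)) +
          Real.log (Real.exp (-2 * b * t))) : ℝ) : ℂ))
      (P.map Z) := by
  set K := c * Real.Gamma (1 - α) / α with hK
  have hψ : ∀ u : ℝ, -(c * β ^ α * Real.Gamma (1 - α) / (2 * α * b)) *
      (integralJ u σ α β (β / Real.exp (-2 * b * t)) + Real.log (Real.exp (-2 * b * t))) =
      -∫ s in (0 : ℝ)..t,
        K * ((β + σ ^ 2 * u ^ 2 / 2 * Real.exp (-2 * b * (t - s))) ^ α - β ^ α) := by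
    intro u
    rw [neg_integral_laplaceExponent hβ hb (by positivity), integralJ, hK]
    congr 2
    field_simp
  have hsq : ∀ s : ℝ, Real.exp (-b * ((t : ℝ) - s)) ^ 2 = Real.exp (-2 * b * (t - s)) := by
    intro s
    rw [← Real.exp_nat_mul]; push_cast; ring_nf
  have hΦ : ∀ u s : ℝ, ∫ x, (1 - Real.exp
      (-(σ ^ 2 * u ^ 2 / 2 * Real.exp (-b * ((t : ℝ) - s)) ^ 2) * x)) ∂temperedStableMeasure α β c =
      K * ((β + σ ^ 2 * u ^ 2 / 2 * Real.exp (-2 * b * (t - s))) ^ α - β ^ α) := by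
    intro u s
    rw [integral_one_sub_exp_temperedStableMeasure hα0 hα1 hβ hc (by positivity), hsq]
  simp only [hψ]
  refine ⟨Complex.continuous_ofReal.comp (continuous_integral_laplaceExponent hβ t), ?_,
    fun u => ?_⟩
  · simp
  · have hcont : Continuous fun s : ℝ =>
        K * ((β + σ ^ 2 * u ^ 2 / 2 * Real.exp (-2 * b * (t - s))) ^ α - β ^ α) :=
      ((Continuous.rpow_const (by fun_prop) fun s => Or.inl (by positivity)).sub
        continuous_const).const_mul K
    have h := charFun_of_isStochIntegral hW hL hWL hZ u (by simpa only [hΦ] using hcont)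
    simp only [hΦ] at h
    rw [h, Complex.ofReal_exp]

end OrnsteinUhlenbeck

theorem mainTheorem2 {Ω : Type*} [MeasurableSpace Ω] (P : Measure Ω) [IsProbabilityMeasure P]
    (α β c σ b : ℝ) (hα0 : 0 < α) (hα1 : α < 1) (hβ : 0 < β) (hc : 0 < c) (hσ : 0 < σ)
    (hb : 0 < b)
    (W : ℝ≥0 → Ω → ℝ) (L : ℝ≥0 → Ω → ℝ≥0)
    (hW : IsBrownianReal W P)
    (hL : IsPureJumpSubordinator (temperedStableMeasure α β c) L P)
    (hWL : IndepFun (fun ω s => W s ω) (fun ω s => L s ω) P) :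
    (∀ t : ℝ≥0,
      (∃ Z : Ω → ℝ, IsOUIntegral P b (subordinated σ W L) t Z) ∧
      ∀ Z : Ω → ℝ, IsOUIntegral P b (subordinated σ W L) t Z →
        ∀ w : ℝ, w = Real.exp (-2 * b * t) →
          IsLogCharFun
            (fun u => ((-(c * β ^ α * Real.Gamma (1 - α) / (2 * α * b)) *
              (integralJ u σ α β (β / w) + Real.log w) : ℝ) : ℂ))
            (P.map Z)) ∧
    (∀ u β₁ β₂ : ℝ, u ≠ 0 → 0 < β₁ → β₁ < β₂ →
      (integralJ u σ α β₁ β₂ : ℂ) =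
        -(1 / (α : ℂ)) *
          ((((σ ^ 2 * u ^ 2 / (2 * β₂)) ^ α : ℝ) : ℂ) *
              gaussHypergeometric (-α) (-α) (1 - α)
                ((-(2 * β₂ / (σ ^ 2 * u ^ 2)) : ℝ) : ℂ)
            - (((σ ^ 2 * u ^ 2 / (2 * β₁)) ^ α : ℝ) : ℂ) *
              gaussHypergeometric (-α) (-α) (1 - α)
                ((-(2 * β₁ / (σ ^ 2 * u ^ 2)) : ℝ) : ℂ))) ∧
    (∀ x : ℝ, 0 ≤ x →
      gaussHypergeometric (-1 / 2) (-1 / 2) (1 / 2) ((-x : ℝ) : ℂ) =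
        ((√(x + 1) - √x * Real.arsinh (√x) : ℝ) : ℂ)) := by
  refine ⟨fun t => ⟨?_, fun Z hZ w hw => ?_⟩, fun u β₁ β₂ hu h1 h12 => ?_, fun x hx => ?_⟩
  · refine exists_isStochIntegral_subordinated hW hL.aemeasurable hL.mono σ
      (f' := fun s => b * Real.exp (-b * ((t : ℝ) - s))) (fun s => ?_) (by fun_prop) t
    convert! ((((hasDerivAt_id s).const_sub (t : ℝ)).const_mul (-b)).exp) using 1
    simp only [id_eq]
    ring
  · subst hw
    exact isLogCharFun_of_isOUIntegral hα0 hα1 hβ hc hb hW hL hWL hZ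
  · exact integralJ_eq_gaussHypergeometric hα0 hα1 hσ hu h1 h12
  · exact gaussHypergeometric_neg_half hx
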